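/- Let $N,d,k\in\mathbb N$ and let $\{H_m\}_{m\in\mathbb N}$ be a universal Hamiltonian family: $H_m$ is a Hermitian operator on $(\mathbb C^d)^{\otimes m}$ with eigenvalues $\lambda_1,\dots,\lambda_{d^m}$ and frequency spectrum $\Omega_{H_m}=\{\lambda_j-\lambda_l : 1\le j,l\le d^m\}$, and for every $K\in\mathbb N$ there is an $m$ with $\{-K,\dots,0,\dots,K\}\subseteq\Omega_{H_m}$. For $x=(x_1,\dots,x_N)\in\mathbb R^N$ put $S_{H_m}(x)=e^{-ix_1H_m}\otimes\cdots\otimes e^{-ix_NH_m}$, and for a state (unit vector) $|\Gamma\rangle\in\big((\mathbb C^d)^{\otimes m}\big)^{\otimes N}$ and an observable (Hermitian operator) $M$ on this space let $$f_m(x)=\langle\Gamma|\,S_{H_m}^\dagger(x)\,M\,S_{H_m}(x)\,|\Gamma\rangle\in\mathbb R .$$ Let $U\subset\mathbb R^N$ be an open set with Lipschitz boundary that is compactly contained in $[0,2\pi]^N$, i.e. $\overline U$ is compact and contained in the interior of $[0,2\pi]^N$. Let $H^k(U)$ be the Sobolev space of real-valued $f\in L^2(U)$ whose weak derivatives $D^\alpha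 f$, $|\alpha|\le k$, exist and belong to $L^2(U)$, with norm $\|f\|_{H^k}=\big(\sum_{|\alpha|\le k}\int_U|D^\alpha f|^2\big)^{1/2}$. Then for every $f^*\in H^k(U)$ and every $\epsilon>0$ there exist $m'\in\mathbb N$, a state $|\Gamma\rangle$ and an observable $M$ such that $f_{m'}-f^*\in H^k(U)$ and $$\|f_{m'}-f^*\|_{H^k}<\epsilon .$$ -/

import Mathlib

open scoped Matrix ContDiff RealInnerProductSpace

noncomputable section

/-! ### Quantum models -/

/-- The tensor (Kronecker) product `A 0 ⊗ ⋯ ⊗ A (N - 1)` of `N` operators on the same space `ℂ^n`,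
as a matrix in the product basis, whose elements are labelled by `Fin N → n`. -/
def tensorProd {N : ℕ} {n : Type*} (A : Fin N → Matrix n n ℂ) :
    Matrix (Fin N → n) (Fin N → n) ℂ :=
  Matrix.of fun J K => ∏ i, A i (J i) (K i)

/-- The data encoding `S_H(x) = exp(-i x₁ H) ⊗ ⋯ ⊗ exp(-i x_N H)`. -/
def encoding {N : ℕ} {n : Type*} [Fintype n] [DecidableEq n] (H : Matrix n n ℂ)
    (x : EuclideanSpace ℝ (Fin N)) : Matrix (Fin N → n) (Fin N → n) ℂ :=
  tensorProd fun i => NormedSpace.exp ((-(Complex.I * (x i : ℂ))) • H)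

/-- `Γ` is a (pure, normalised) state. -/
def IsState {ι : Type*} [Fintype ι] (Γ : ι → ℂ) : Prop :=
  star Γ ⬝ᵥ Γ = 1

/-- The complex number `⟨Γ| S_H(x)† M S_H(x) |Γ⟩`. -/
def expectation {N : ℕ} {n : Type*} [Fintype n] [DecidableEq n] (H : Matrix n n ℂ)
    (Γ : (Fin N → n) → ℂ) (M : Matrix (Fin N → n) (Fin N → n) ℂ)
    (x : EuclideanSpace ℝ (Fin N)) : ℂ :=
  star Γ ⬝ᵥ (((encoding H x)ᴴ * M * encoding H x) *ᵥ Γ)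

/-- For an observable (a Hermitian matrix) `M` the expectation is a real number. -/
theorem expectation_im {N : ℕ} {n : Type*} [Fintype n] [DecidableEq n] (H : Matrix n n ℂ)
    (Γ : (Fin N → n) → ℂ) (M : Matrix (Fin N → n) (Fin N → n) ℂ) (hM : M.IsHermitian)
    (x : EuclideanSpace ℝ (Fin N)) : (expectation H Γ M x).im = 0 := by
  have h : ((encoding H x)ᴴ * M * encoding H x).IsHermitian :=
    Matrix.isHermitian_conjTranspose_mul_mul _ hM
  exact h.im_star_dotProduct_mulVec_self Γ

/-- The quantum model `f(x) = ⟨Γ| S_H(x)† M S_H(x) |Γ⟩`, as a real-valued function. -/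
def quantumModel {N : ℕ} {n : Type*} [Fintype n] [DecidableEq n] (H : Matrix n n ℂ)
    (Γ : (Fin N → n) → ℂ) (M : Matrix (Fin N → n) (Fin N → n) ℂ)
    (x : EuclideanSpace ℝ (Fin N)) : ℝ :=
  (expectation H Γ M x).re

/-- The frequency spectrum of a Hamiltonian: all differences of two of its eigenvalues. -/
def frequencySpectrum {n : Type*} [Fintype n] [DecidableEq n] {H : Matrix n n ℂ}
    (hH : H.IsHermitian) : Set ℝ :=
  {w | ∃ j k, w = hH.eigenvalues j - hH.eigenvalues k}

/-- A Hamiltonian family, where `H m` acts on `m` subsystems of dimension `d`, is universal if for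
every `K` some frequency spectrum contains all the integers `-K, …, K`. -/
def IsUniversalFamily {d : ℕ} {H : ∀ m : ℕ, Matrix (Fin m → Fin d) (Fin m → Fin d) ℂ}
    (hH : ∀ m, (H m).IsHermitian) : Prop :=
  ∀ K : ℕ, ∃ m : ℕ, ∀ z : ℤ, |z| ≤ (K : ℤ) → (z : ℝ) ∈ frequencySpectrum (hH m)

/-! ### Domains -/

/-- `U` is compactly contained in `V`. -/
def CompactlyContained {E : Type*} [TopologicalSpace E] (U V : Set E) : Prop :=
  IsCompact (closure U) ∧ closure U ⊆ interior V

/-- The closed cube `[0, 2π]^N`. -/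
def cube (N : ℕ) : Set (EuclideanSpace ℝ (Fin N)) :=
  {x | ∀ i, x i ∈ Set.Icc 0 (2 * Real.pi)}

/-- `U` has Lipschitz boundary: near each boundary point `p` there are a direction `e` (a unit
vector) and a Lipschitz function `γ` on the hyperplane orthogonal to `e` such that `U` is the part
of a ball around `p` lying strictly above the graph of `γ` in direction `e`. The point
`x - ⟪e, x⟫ • e` is the orthogonal projection of `x` to the hyperplane, so that only the values
of `γ` on the hyperplane matter. -/
def HasLipschitzBoundary {N : ℕ} (U : Set (EuclideanSpace ℝ (Fin N))) : Prop :=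
  ∀ p ∈ frontier U, ∃ r > (0 : ℝ), ∃ e : EuclideanSpace ℝ (Fin N), ‖e‖ = 1 ∧
    ∃ (γ : EuclideanSpace ℝ (Fin N) → ℝ) (L : NNReal),
      LipschitzOnWith L γ {y | ⟪e, y⟫ = 0} ∧
      ∀ x ∈ Metric.ball p r, x ∈ U ↔ γ (x - ⟪e, x⟫ • e) < ⟪e, x⟫

/-! ### Sobolev spaces -/

/-- The classical partial derivative `∂g/∂x_i`. -/
def partialDeriv {N : ℕ} (i : Fin N) (g : EuclideanSpace ℝ (Fin N) → ℝ) :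
    EuclideanSpace ℝ (Fin N) → ℝ :=
  fun x => fderiv ℝ g x (EuclideanSpace.single i 1)

/-- The classical derivative `D^α g = ∂₁^{α₁} ⋯ ∂_N^{α_N} g` for a multi-index `α`
(it is used for smooth `g` only). -/
def multiDeriv {N : ℕ} (α : Fin N → ℕ) (g : EuclideanSpace ℝ (Fin N) → ℝ) :
    EuclideanSpace ℝ (Fin N) → ℝ :=
  (List.finRange N).foldr (fun i h => (partialDeriv i)^[α i] h) g

/-- `g` is the weak derivative `D^α f` on the open set `U`. -/
def HasWeakDeriv {N : ℕ} (U : Set (EuclideanSpace ℝ (Fin N))) (α : Fin N → ℕ)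
    (f g : EuclideanSpace ℝ (Fin N) → ℝ) : Prop :=
  MeasureTheory.LocallyIntegrableOn f U ∧ MeasureTheory.LocallyIntegrableOn g U ∧
  ∀ φ : EuclideanSpace ℝ (Fin N) → ℝ, ContDiff ℝ ∞ φ → HasCompactSupport φ → tsupport φ ⊆ U →
    ∫ x in U, f x * multiDeriv α φ x = (-1) ^ (∑ i, α i) * ∫ x in U, g x * φ x

open Classical in
/-- The weak derivative `D^α f` on `U` (zero if it does not exist); it is determined by `f` up to
a null set of `U`. -/
def weakDeriv {N : ℕ} (U : Set (EuclideanSpace ℝ (Fin N))) (α : Fin N → ℕ)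
    (f : EuclideanSpace ℝ (Fin N) → ℝ) : EuclideanSpace ℝ (Fin N) → ℝ :=
  if h : ∃ g, HasWeakDeriv U α f g then h.choose else 0

/-- `f ∈ H^k(U)`: `f` is square integrable on `U`, and so are its weak derivatives `D^α f`,
`|α| ≤ k`, which exist. Only the values of `f` on `U` matter. -/
def MemSobolev {N : ℕ} (k : ℕ) (U : Set (EuclideanSpace ℝ (Fin N)))
    (f : EuclideanSpace ℝ (Fin N) → ℝ) : Prop :=
  MeasureTheory.MemLp f 2 (MeasureTheory.volume.restrict U) ∧
  ∀ α : Fin N → ℕ, ∑ i, α i ≤ k →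
    ∃ g, HasWeakDeriv U α f g ∧ MeasureTheory.MemLp g 2 (MeasureTheory.volume.restrict U)

/-- The finite set of multi-indices `α` with `|α| ≤ k`. -/
def multiIndices (N k : ℕ) : Finset (Fin N → ℕ) :=
  (Finset.range (k + 1)).biUnion fun n => Finset.piAntidiag Finset.univ n

theorem mem_multiIndices {N k : ℕ} (α : Fin N → ℕ) : α ∈ multiIndices N k ↔ ∑ i, α i ≤ k := by
  simp [multiIndices, Finset.mem_piAntidiag]

/-- The norm of `H^k(U)`: `‖f‖ = (∑_{|α| ≤ k} ∫_U |D^α f|²)^{1/2}`. -/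
def sobolevNorm {N : ℕ} (k : ℕ) (U : Set (EuclideanSpace ℝ (Fin N)))
    (f : EuclideanSpace ℝ (Fin N) → ℝ) : ℝ :=
  Real.sqrt (∑ α ∈ multiIndices N k, ∫ x in U, |weakDeriv U α f x| ^ 2)

end

/-! Two density results are combined, and their outcome is realised exactly as a quantum model.

Smooth functions on `ℝ^N` are dense in `H^k(U)` (`MemSobolev.exists_sobolevClose`). A partition of
unity localises `f`. Near a boundary point `U` lies above a Lipschitz graph, and a mollifier shifted
along the inner direction reads only values from inside `U`
(`HasInwardMollifiers.of_lipschitz_graph`). Mollification therefore commutes with weak derivatives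
at every point of `U`.

A smooth `g` is cut off inside the open cube and convolved with normalised powers of `∏ (1 + cos
x_i) / 2`, which concentrate at `2πℤ^N` (`exists_isTrigPoly_eLpNorm_le`). Since `U` stays inside the
open cube, only the peak at the origin is seen. Derivatives fall on the cut-off function, so a
single trigonometric polynomial approximates all of them.

In an eigenbasis of `H` the encoding acts by phases `exp(-i ∑ x_i λ_{J i})`, and the entry `(a, b)`
of the observable contributes the frequency vector with coordinates `λ_{a i} - λ_{b i}`
(`exists_quantumModel_eq`). A trigonometric polynomial is thus a model as soon as its finitely many
integer frequencies and `0` lie in the spectrum, which universality provides. -/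

/-! ### Iterated partial derivatives -/

section Calculus

open MeasureTheory

variable {N : ℕ}

/-- Shorthand for the Euclidean space of dimension `N`. -/
abbrev Eucl (N : ℕ) : Type := EuclideanSpace ℝ (Fin N)

theorem ContDiff.partialDeriv {g : Eucl N → ℝ} (hg : ContDiff ℝ ∞ g) (i : Fin N) :
    ContDiff ℝ ∞ (partialDeriv i g) :=
  (hg.fderiv_right (m := ∞) (by simp)).clm_apply contDiff_const

theorem partialDeriv_comm {g : Eucl N → ℝ} (hg : ContDiff ℝ ∞ g) (i j : Fin N) :
    partialDeriv i (partialDeriv j g) = partialDeriv j (partialDeriv i g) := by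
  have hd : Differentiable ℝ (fderiv ℝ g) :=
    (hg.fderiv_right (m := ∞) (by simp)).differentiable (by simp)
  have key : ∀ (a b : Fin N) (x : Eucl N), _root_.partialDeriv a (_root_.partialDeriv b g) x =
      fderiv ℝ (fderiv ℝ g) x (EuclideanSpace.single a 1) (EuclideanSpace.single b 1) := by
    intro a b x
    unfold _root_.partialDeriv
    rw [fderiv_clm_apply (hd x) (by fun_prop)]
    simp
  funext x
  rw [key, key]
  exact (hg.contDiffAt.isSymmSndFDerivAt
    (by simpa using WithTop.coe_le_coe.2 (le_top : (2 : ℕ∞) ≤ ⊤))).eq _ _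

/-- A relation which is stable under all partial derivatives is stable under `D^α`. -/
theorem multiDeriv_induction {R : (Eucl N → ℝ) → (Eucl N → ℝ) → Prop}
    (hR : ∀ i g h, R g h → R (partialDeriv i g) (partialDeriv i h)) (α : Fin N → ℕ)
    {g h : Eucl N → ℝ} (hgh : R g h) : R (multiDeriv α g) (multiDeriv α h) := by
  unfold multiDeriv
  induction List.finRange N with
  | nil => exact hgh
  | cons a l ih =>
    simp only [List.foldr_cons]
    generalize α a = n
    induction n with
    | zero => exact ih
    | succ n ihn =>
      rw [Function.iterate_succ_apply', Function.iterate_succ_apply']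
      exact hR _ _ _ ihn

/-- A property which is stable under all partial derivatives is stable under `D^α`. -/
theorem multiDeriv_induction_pred {P : (Eucl N → ℝ) → Prop}
    (hP : ∀ i g, P g → P (partialDeriv i g)) (α : Fin N → ℕ)
    {g : Eucl N → ℝ} (hg : P g) : P (multiDeriv α g) :=
  multiDeriv_induction (R := fun g _ => P g) (fun i g _ h => hP i g h) α (h := g) hg

theorem ContDiff.multiDeriv {g : Eucl N → ℝ} (hg : ContDiff ℝ ∞ g) (α : Fin N → ℕ) :
    ContDiff ℝ ∞ (multiDeriv α g) :=
  multiDeriv_induction_pred (P := fun g => ContDiff ℝ ∞ g) (fun i _ h => h.partialDeriv i) α hg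

theorem multiDeriv_zero (g : Eucl N → ℝ) : multiDeriv (0 : Fin N → ℕ) g = g := by
  unfold multiDeriv
  induction List.finRange N with
  | nil => rfl
  | cons a l ih => simp

theorem tsupport_partialDeriv_subset (g : Eucl N → ℝ) (i : Fin N) :
    tsupport (partialDeriv i g) ⊆ tsupport g :=
  tsupport_fderiv_apply_subset ℝ _

theorem tsupport_multiDeriv_subset (g : Eucl N → ℝ) (α : Fin N → ℕ) :
    tsupport (multiDeriv α g) ⊆ tsupport g :=
  multiDeriv_induction_pred (P := fun h => tsupport h ⊆ tsupport g)
    (fun i h hh => (tsupport_partialDeriv_subset h i).trans hh) α le_rfl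

theorem HasCompactSupport.multiDeriv {g : Eucl N → ℝ} (hg : HasCompactSupport g)
    (α : Fin N → ℕ) : HasCompactSupport (multiDeriv α g) :=
  hg.of_isClosed_subset (isClosed_tsupport _) (tsupport_multiDeriv_subset g α)

theorem Set.EqOn.multiDeriv {g h : Eucl N → ℝ} {U : Set (Eucl N)} (hU : IsOpen U)
    (hgh : Set.EqOn g h U) (α : Fin N → ℕ) : Set.EqOn (multiDeriv α g) (multiDeriv α h) U := by
  refine multiDeriv_induction (R := fun g h => Set.EqOn g h U) (fun i g h H x hx => ?_) α hgh
  have : g =ᶠ[nhds x] h := Filter.eventuallyEq_of_mem (hU.mem_nhds hx) H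
  simp only [partialDeriv, this.fderiv_eq]

theorem partialDeriv_iterate_comm {g : Eucl N → ℝ} (hg : ContDiff ℝ ∞ g) (i j : Fin N) (n : ℕ) :
    partialDeriv i ((partialDeriv j)^[n] g) = (partialDeriv j)^[n] (partialDeriv i g) := by
  induction n generalizing g with
  | zero => rfl
  | succ n ih =>
    rw [Function.iterate_succ_apply, Function.iterate_succ_apply, ih (hg.partialDeriv j),
      partialDeriv_comm hg]

theorem partialDeriv_multiDeriv {g : Eucl N → ℝ} (hg : ContDiff ℝ ∞ g) (i : Fin N)
    (α : Fin N → ℕ) : partialDeriv i (multiDeriv α g) = multiDeriv α (partialDeriv i g) :=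
  (multiDeriv_induction (R := fun g h => ContDiff ℝ ∞ g ∧ partialDeriv i g = h)
    (fun j g h H => ⟨H.1.partialDeriv j, by rw [← H.2, partialDeriv_comm H.1]⟩) α ⟨hg, rfl⟩).2

/-- The fold takes the coordinates in a fixed order, so the extra derivative lands in the middle and
must be commuted outwards, which needs smoothness. As the list has no repetitions, it is met only
once. -/
theorem multiDeriv_add_single {g : Eucl N → ℝ} (hg : ContDiff ℝ ∞ g) (i : Fin N)
    (α : Fin N → ℕ) : multiDeriv (α + Pi.single i 1) g = partialDeriv i (multiDeriv α g) := by
  have hsm : ∀ l : List (Fin N),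
      ContDiff ℝ ∞ (l.foldr (fun i h => (partialDeriv i)^[α i] h) g) := by
    intro l
    induction l with
    | nil => exact hg
    | cons a l ih =>
      simp only [List.foldr_cons]
      generalize α a = n
      induction n with
      | zero => exact ih
      | succ n ihn =>
        rw [Function.iterate_succ_apply']
        exact ihn.partialDeriv a
  have key : ∀ l : List (Fin N), l.Nodup →
      l.foldr (fun j h => (partialDeriv j)^[(α + Pi.single i 1 : Fin N → ℕ) j] h) g =
        if i ∈ l then partialDeriv i (l.foldr (fun j h => (partialDeriv j)^[α j] h) g)
        else l.foldr (fun j h => (partialDeriv j)^[α j] h) g := by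
    intro l hl
    induction l with
    | nil => simp
    | cons a l ih =>
      rw [List.nodup_cons] at hl
      simp only [List.foldr_cons, ih hl.2]
      by_cases ha : i = a
      · subst ha
        simp [hl.1, Function.iterate_succ_apply']
      · have : (α + Pi.single i 1 : Fin N → ℕ) a = α a := by
          simp [Ne.symm ha]
        rw [this]
        by_cases hi : i ∈ l
        · simp [hi, partialDeriv_iterate_comm (hsm l)]
        · simp [hi, ha]
  have := key _ (List.nodup_finRange N)
  simpa [multiDeriv] using this

/-- Three functions vary together, while `multiDeriv_induction` relates two; hence the fold is
unrolled by hand. -/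
theorem multiDeriv_add {g h : Eucl N → ℝ} (hg : ContDiff ℝ ∞ g) (hh : ContDiff ℝ ∞ h)
    (α : Fin N → ℕ) :
    multiDeriv α (fun x => g x + h x) = fun x => multiDeriv α g x + multiDeriv α h x := by
  have hd : ∀ {g : Eucl N → ℝ}, ContDiff ℝ ∞ g → Differentiable ℝ g :=
    fun h => h.differentiable (by simp)
  unfold multiDeriv
  suffices H : ∀ l : List (Fin N), ∃ u v, ContDiff ℝ ∞ u ∧ ContDiff ℝ ∞ v ∧
      l.foldr (fun i h => (partialDeriv i)^[α i] h) g = u ∧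
      l.foldr (fun i h => (partialDeriv i)^[α i] h) h = v ∧
      l.foldr (fun i h => (partialDeriv i)^[α i] h) (fun x => g x + h x) =
        fun x => u x + v x by
    obtain ⟨u, v, -, -, rfl, rfl, h⟩ := H (List.finRange N)
    exact h
  intro l
  induction l with
  | nil => exact ⟨g, h, hg, hh, rfl, rfl, rfl⟩
  | cons a l ih =>
    simp only [List.foldr_cons]
    generalize α a = n
    induction n with
    | zero => exact ih
    | succ n ihn =>
      obtain ⟨u, v, hu, hv, h1, h2, h3⟩ := ihn
      refine ⟨_, _, hu.partialDeriv a, hv.partialDeriv a, ?_, ?_, ?_⟩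
      · rw [Function.iterate_succ_apply', h1]
      · rw [Function.iterate_succ_apply', h2]
      · rw [Function.iterate_succ_apply', h3]
        funext x
        simp only [partialDeriv]
        rw [fderiv_fun_add (hd hu x) (hd hv x)]
        rfl

end Calculus

/-! ### Weak derivatives -/

section WeakDerivatives

open MeasureTheory

variable {N : ℕ}

/-- With `multiDeriv_add_single`, this reduces statements about `D^α` to one further partial
derivative. -/
theorem multiIndex_induction {P : (Fin N → ℕ) → Prop} (zero : P 0)
    (step : ∀ α i, P α → P (α + Pi.single i 1)) (α : Fin N → ℕ) : P α := by
  induction hn : ∑ i, α i generalizing α with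
  | zero =>
    have : α = 0 := by
      funext i
      exact Finset.sum_eq_zero_iff.1 hn i (Finset.mem_univ i)
    exact this ▸ zero
  | succ n ih =>
    obtain ⟨i, -, hi⟩ : ∃ i ∈ Finset.univ, α i ≠ 0 := by
      by_contra! h
      rw [Finset.sum_eq_zero h] at hn
      omega
    have hα : α = (α - Pi.single i 1) + Pi.single i 1 := by
      funext j
      by_cases hj : j = i
      · subst hj
        simp only [Pi.add_apply, Pi.sub_apply, Pi.single_eq_same]
        omega
      · simp [hj]
    rw [hα]
    refine step _ _ (ih _ ?_)
    rw [hα] at hn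
    simp only [Pi.add_apply, Finset.sum_add_distrib, Finset.sum_pi_single', Finset.mem_univ,
      if_true] at hn
    simpa using hn

theorem sum_add_single (α : Fin N → ℕ) (i : Fin N) :
    ∑ j, (α + Pi.single i 1 : Fin N → ℕ) j = ∑ j, α j + 1 := by
  simp [Finset.sum_add_distrib]

theorem multiDeriv_single {g : Eucl N → ℝ} (hg : ContDiff ℝ ∞ g) (i : Fin N) :
    multiDeriv (Pi.single i 1) g = partialDeriv i g := by
  have := multiDeriv_add_single hg i 0
  rwa [zero_add, multiDeriv_zero] at this

theorem partialDeriv_mul {g h : Eucl N → ℝ} (hg : ContDiff ℝ ∞ g) (hh : ContDiff ℝ ∞ h)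
    (i : Fin N) : partialDeriv i (fun x => g x * h x) =
      fun x => partialDeriv i g x * h x + g x * partialDeriv i h x := by
  funext x
  simp only [partialDeriv]
  rw [fderiv_fun_mul (hg.differentiable (by simp) x) (hh.differentiable (by simp) x)]
  simp only [add_apply, smul_apply, smul_eq_mul]
  ring

theorem integral_mul_partialDeriv {g η : Eucl N → ℝ} (hg : ContDiff ℝ ∞ g)
    (hη : ContDiff ℝ ∞ η) (hc : HasCompactSupport η) (i : Fin N) :
    ∫ x, g x * partialDeriv i η x = - ∫ x, partialDeriv i g x * η x := by
  have hcd : HasCompactSupport (partialDeriv i η) :=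
    hc.of_isClosed_subset (isClosed_tsupport _) (tsupport_partialDeriv_subset η i)
  refine integral_mul_fderiv_eq_neg_fderiv_mul_of_integrable ?_ ?_ ?_ ?_ ?_
  · exact ((hg.partialDeriv i).continuous.mul hη.continuous).integrable_of_hasCompactSupport
      hc.mul_left
  · exact (hg.continuous.mul (hη.partialDeriv i).continuous).integrable_of_hasCompactSupport
      hcd.mul_left
  · exact (hg.continuous.mul hη.continuous).integrable_of_hasCompactSupport hc.mul_left
  · exact fun x _ => hg.differentiable (by simp) x
  · exact fun x _ => hη.differentiable (by simp) x

theorem setIntegral_mul_of_tsupport_subset {U : Set (Eucl N)} {φ : Eucl N → ℝ}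
    (hφ : tsupport φ ⊆ U) (F : Eucl N → ℝ) : ∫ x in U, F x * φ x = ∫ x, F x * φ x :=
  setIntegral_eq_integral_of_forall_compl_eq_zero fun x hx => by
    rw [image_eq_zero_of_notMem_tsupport fun h => hx (hφ h), mul_zero]

/-- The classical derivatives of a smooth function are weak derivatives. -/
theorem ContDiff.hasWeakDeriv {g : Eucl N → ℝ} (hg : ContDiff ℝ ∞ g) (U : Set (Eucl N))
    (α : Fin N → ℕ) : HasWeakDeriv U α g (_root_.multiDeriv α g) := by
  refine ⟨hg.continuous.locallyIntegrable.locallyIntegrableOn U,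
    (hg.multiDeriv α).continuous.locallyIntegrable.locallyIntegrableOn U, fun η hη hc hs => ?_⟩
  rw [setIntegral_mul_of_tsupport_subset ((tsupport_multiDeriv_subset η α).trans hs),
    setIntegral_mul_of_tsupport_subset hs]
  clear hs
  induction α using multiIndex_induction generalizing g with
  | zero => simp [multiDeriv_zero]
  | step α i ih =>
    rw [multiDeriv_add_single hη, integral_mul_partialDeriv hg (hη.multiDeriv α) (hc.multiDeriv α),
      ih (hg.partialDeriv i), multiDeriv_add_single hg, partialDeriv_multiDeriv hg, sum_add_single,
      pow_succ]
    ring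

theorem LocallyIntegrableOn.integrableOn_mul_of_hasCompactSupport {U : Set (Eucl N)}
    {f φ : Eucl N → ℝ} (hf : LocallyIntegrableOn f U) (hφ : Continuous φ)
    (hc : HasCompactSupport φ) (hs : tsupport φ ⊆ U) :
    IntegrableOn (fun x => f x * φ x) U := by
  have h1 : IntegrableOn (fun x => f x * φ x) (tsupport φ) :=
    (hf.integrableOn_compact_subset hs hc).mul_continuousOn hφ.continuousOn hc
  have h2 : Integrable (fun x => f x * φ x) :=
    (integrableOn_iff_integrable_of_support_subset fun x hx => subset_tsupport φ (by
      intro h0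
      simp [h0] at hx)).1 h1
  exact h2.integrableOn

theorem MeasureTheory.MemLp.locallyIntegrableOn {U : Set (Eucl N)}
    {f : Eucl N → ℝ} (hf : MemLp f 2 (volume.restrict U)) : LocallyIntegrableOn f U :=
  locallyIntegrableOn_of_locallyIntegrable_restrict (hf.locallyIntegrable (by norm_num))

/-- Weak derivatives are unique. -/
theorem HasWeakDeriv.ae_eq {U : Set (Eucl N)} (hU : IsOpen U) {α : Fin N → ℕ}
    {f g h : Eucl N → ℝ} (hg : HasWeakDeriv U α f g) (hh : HasWeakDeriv U α f h) :
    g =ᵐ[volume.restrict U] h := by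
  have key := hU.ae_eq_zero_of_integral_contDiff_smul_eq_zero (hg.2.1.sub hh.2.1) (by
    intro η hη hc hs
    have e1 := hg.2.2 η hη hc hs
    rw [hh.2.2 η hη hc hs] at e1
    have e2 : ∫ x in U, g x * η x = ∫ x in U, h x * η x :=
      (mul_left_cancel₀ (pow_ne_zero _ (by norm_num)) e1).symm
    have e3 : ∫ x in U, (g x * η x - h x * η x) = 0 := by
      rw [integral_sub (LocallyIntegrableOn.integrableOn_mul_of_hasCompactSupport hg.2.1
        hη.continuous hc hs) (LocallyIntegrableOn.integrableOn_mul_of_hasCompactSupport hh.2.1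
        hη.continuous hc hs), e2, sub_self]
    rw [← e3, ← setIntegral_eq_integral_of_forall_compl_eq_zero (s := U)]
    · refine setIntegral_congr_fun hU.measurableSet fun x _ => ?_
      simp only [Pi.sub_apply, smul_eq_mul]
      ring
    · intro x hx
      rw [image_eq_zero_of_notMem_tsupport fun h => hx (hs h), zero_smul])
  rw [Filter.EventuallyEq, ae_restrict_iff' hU.measurableSet]
  filter_upwards [key] with x hx hxU
  exact sub_eq_zero.1 (hx hxU)

theorem HasWeakDeriv.add {U : Set (Eucl N)} {α : Fin N → ℕ} {f₁ f₂ g₁ g₂ : Eucl N → ℝ}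
    (h₁ : HasWeakDeriv U α f₁ g₁) (h₂ : HasWeakDeriv U α f₂ g₂) :
    HasWeakDeriv U α (fun x => f₁ x + f₂ x) (fun x => g₁ x + g₂ x) := by
  refine ⟨h₁.1.add h₂.1, h₁.2.1.add h₂.2.1, fun η hη hc hs => ?_⟩
  have hs' := (tsupport_multiDeriv_subset η α).trans hs
  simp only [add_mul]
  rw [integral_add, integral_add, h₁.2.2 η hη hc hs, h₂.2.2 η hη hc hs, mul_add]
  · exact LocallyIntegrableOn.integrableOn_mul_of_hasCompactSupport h₁.2.1 hη.continuous hc hs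
  · exact LocallyIntegrableOn.integrableOn_mul_of_hasCompactSupport h₂.2.1 hη.continuous hc hs
  · exact LocallyIntegrableOn.integrableOn_mul_of_hasCompactSupport h₁.1
      (hη.multiDeriv α).continuous (hc.multiDeriv α) hs'
  · exact LocallyIntegrableOn.integrableOn_mul_of_hasCompactSupport h₂.1
      (hη.multiDeriv α).continuous (hc.multiDeriv α) hs'

theorem HasWeakDeriv.neg {U : Set (Eucl N)} {α : Fin N → ℕ} {f g : Eucl N → ℝ}
    (h : HasWeakDeriv U α f g) : HasWeakDeriv U α (fun x => -f x) (fun x => -g x) := by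
  refine ⟨h.1.neg, h.2.1.neg, fun η hη hc hs => ?_⟩
  simp only [neg_mul, integral_neg, h.2.2 η hη hc hs, mul_neg]

theorem HasWeakDeriv.sub {U : Set (Eucl N)} {α : Fin N → ℕ} {f₁ f₂ g₁ g₂ : Eucl N → ℝ}
    (h₁ : HasWeakDeriv U α f₁ g₁) (h₂ : HasWeakDeriv U α f₂ g₂) :
    HasWeakDeriv U α (fun x => f₁ x - f₂ x) (fun x => g₁ x - g₂ x) := by
  simpa only [sub_eq_add_neg] using h₁.add h₂.neg

theorem HasWeakDeriv.congr_left {U : Set (Eucl N)} (hU : IsOpen U) {α : Fin N → ℕ}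
    {f f' g : Eucl N → ℝ} (h : HasWeakDeriv U α f g) (hf : Set.EqOn f f' U) :
    HasWeakDeriv U α f' g := by
  refine ⟨h.1.congr ?_, h.2.1, fun η hη hc hs => ?_⟩
  · exact (ae_restrict_iff' hU.measurableSet).2 (Filter.Eventually.of_forall hf)
  · rw [← h.2.2 η hη hc hs]
    exact setIntegral_congr_fun hU.measurableSet fun x hx => by simp only [hf hx]

/-- The weak partial derivatives of `f ∈ H^{n+1}` belong to `H^n`. -/
theorem MemSobolev.of_hasWeakDeriv_single {U : Set (Eucl N)} {n : ℕ} {f fi : Eucl N → ℝ}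
    (hf : MemSobolev (n + 1) U f) {i : Fin N} (hfi : HasWeakDeriv U (Pi.single i 1) f fi)
    (hL : MemLp fi 2 (volume.restrict U)) : MemSobolev n U fi := by
  refine ⟨hL, fun α hα => ?_⟩
  obtain ⟨g, hg, hgL⟩ := hf.2 (α + Pi.single i 1) (by rw [sum_add_single]; omega)
  refine ⟨g, ⟨hfi.2.1, hg.2.1, fun η hη hc hs => ?_⟩, hgL⟩
  -- With `D^α η` as test function, the definition of `fi` produces `D^(α+e_i) η`, so the derivative
  -- of `f` of order `α + e_i` also serves as `D^α fi`.
  have e1 := hfi.2.2 _ (hη.multiDeriv α) (hc.multiDeriv α)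
    ((tsupport_multiDeriv_subset η α).trans hs)
  have e2 := hg.2.2 η hη hc hs
  rw [multiDeriv_single (hη.multiDeriv α), ← multiDeriv_add_single hη, e2, sum_add_single] at e1
  simp only [Finset.sum_pi_single', Finset.mem_univ, if_true, pow_succ] at e1
  linarith

/-- Multiplication with smooth functions preserves `H^n`. -/
theorem MemSobolev.mul_smooth {U : Set (Eucl N)} {n : ℕ} {f φ : Eucl N → ℝ}
    (hf : MemSobolev n U f) (hφ : ContDiff ℝ ∞ φ) (hc : HasCompactSupport φ) :
    MemSobolev n U (fun x => φ x * f x) := by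
  have hL : ∀ {f φ : Eucl N → ℝ}, MemLp f 2 (volume.restrict U) → ContDiff ℝ ∞ φ →
      HasCompactSupport φ → MemLp (fun x => φ x * f x) 2 (volume.restrict U) := by
    intro f φ hf hφ hc
    exact hf.mul (p := ⊤) (hφ.continuous.memLp_top_of_hasCompactSupport hc _)
  -- Induction on the order replaces the Leibniz formula: `D^(β+e_i)(φ f) = D^β(∂_i φ · f) + D^β(φ ·
  -- ∂_i f)`, where both products belong to `H^n`.
  induction n generalizing f φ with
  | zero =>
    refine ⟨hL hf.1 hφ hc, fun α hα => ⟨_, ⟨(hL hf.1 hφ hc).locallyIntegrableOn,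
      (hL hf.1 hφ hc).locallyIntegrableOn, fun η _ _ _ => ?_⟩, hL hf.1 hφ hc⟩⟩
    have : α = 0 := funext fun i => Finset.sum_eq_zero_iff.1 (Nat.le_zero.1 hα) i
      (Finset.mem_univ i)
    simp [this, multiDeriv_zero]
  | succ n ih =>
    refine ⟨hL hf.1 hφ hc, fun α hα => ?_⟩
    have hf' : MemSobolev n U f := ⟨hf.1, fun β hβ => hf.2 β (by omega)⟩
    revert hα
    -- Only the case split `α = 0` or `α = β + e_i` is used; the induction hypothesis is discarded.
    refine multiIndex_induction (P := fun α => ∑ i, α i ≤ n + 1 → ∃ g, HasWeakDeriv U α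
      (fun x => φ x * f x) g ∧ MemLp g 2 (volume.restrict U)) (fun _ => ?_)
      (fun β i _ hα => ?_) α
    · exact (ih hf' hφ hc).2 0 (by simp)
    rw [sum_add_single] at hα
    obtain ⟨fi, hfi, hfiL⟩ := hf.2 (Pi.single i 1) (by simp)
    have hci : HasCompactSupport (partialDeriv i φ) :=
      hc.of_isClosed_subset (isClosed_tsupport _) (tsupport_partialDeriv_subset φ i)
    obtain ⟨a, ha, haL⟩ := (ih hf' (hφ.partialDeriv i) hci).2 β (by omega)
    obtain ⟨b, hb, hbL⟩ := (ih (hf.of_hasWeakDeriv_single hfi hfiL) hφ hc).2 β (by omega)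
    refine ⟨fun x => a x + b x, ⟨(hL hf.1 hφ hc).locallyIntegrableOn, ha.2.1.add hb.2.1,
      fun η hη hηc hs => ?_⟩, haL.add hbL⟩
    rw [multiDeriv_add_single hη]
    have hψ := hη.multiDeriv β
    have hψc := hηc.multiDeriv β
    have hψs := (tsupport_multiDeriv_subset η β).trans hs
    have e1 := ha.2.2 η hη hηc hs
    have e2 := hb.2.2 η hη hηc hs
    have eab := (ha.add hb).2.2 η hη hηc hs
    have e3 := hfi.2.2 (fun x => φ x * multiDeriv β η x) (hφ.mul hψ) hψc.mul_left
      ((tsupport_mul_subset_right).trans hψs)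
    rw [multiDeriv_single (hφ.mul hψ), partialDeriv_mul hφ hψ] at e3
    simp only [Finset.sum_pi_single', Finset.mem_univ, if_true, pow_one, mul_add] at e3
    set ψ := multiDeriv β η
    rw [integral_add] at e3
    · rw [sum_add_single, pow_succ]
      have e4 : ∫ x in U, f x * (φ x * partialDeriv i ψ x) =
        ∫ x in U, φ x * f x * partialDeriv i ψ x := by congr 1; ext x; ring
      have e5 : ∫ x in U, f x * (partialDeriv i φ x * ψ x) =
        ∫ x in U, partialDeriv i φ x * f x * ψ x := by congr 1; ext x; ring
      have e6 : ∫ x in U, fi x * (φ x * ψ x) = ∫ x in U, φ x * fi x * ψ x := by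
        congr 1; ext x; ring
      have e7 : ∫ x in U, (a x + b x) * η x = ∫ x in U, a x * η x + b x * η x := by
        congr 1; ext x; ring
      rw [integral_add] at e7
      · rw [e7, ← e4]
        rw [e5, e6, e1, e2] at e3
        linear_combination e3
      · exact LocallyIntegrableOn.integrableOn_mul_of_hasCompactSupport ha.2.1 hη.continuous
          hηc hs
      · exact LocallyIntegrableOn.integrableOn_mul_of_hasCompactSupport hb.2.1 hη.continuous
          hηc hs
    · exact LocallyIntegrableOn.integrableOn_mul_of_hasCompactSupport hfi.1
        ((hφ.partialDeriv i).continuous.mul hψ.continuous) hψc.mul_left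
        (tsupport_mul_subset_right.trans hψs)
    · have hd : HasCompactSupport (partialDeriv i ψ) :=
        hψc.of_isClosed_subset (isClosed_tsupport _) (tsupport_partialDeriv_subset ψ i)
      exact LocallyIntegrableOn.integrableOn_mul_of_hasCompactSupport hfi.1
        (hφ.continuous.mul (hψ.partialDeriv i).continuous) hd.mul_left
        (tsupport_mul_subset_right.trans ((tsupport_partialDeriv_subset ψ i).trans hψs))

end WeakDerivatives

/-! ### Convolutions -/

section Convolutions

open MeasureTheory
open scoped Convolution ENNReal

variable {N : ℕ}

/-- The convolution of two real functions on `ℝ^N`. -/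
noncomputable def conv (f ρ : Eucl N → ℝ) : Eucl N → ℝ :=
  f ⋆[ContinuousLinearMap.mul ℝ ℝ, volume] ρ

theorem conv_apply (f ρ : Eucl N → ℝ) (x : Eucl N) :
    conv f ρ x = ∫ z, f z * ρ (x - z) := rfl

theorem conv_apply_swap (f ρ : Eucl N → ℝ) (x : Eucl N) :
    conv f ρ x = ∫ y, f (x - y) * ρ y :=
  convolution_mul_swap

theorem partialDeriv_conv {f ρ : Eucl N → ℝ} (hf : LocallyIntegrable f)
    (hρ : ContDiff ℝ ∞ ρ) (hc : HasCompactSupport ρ) (i : Fin N) :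
    partialDeriv i (conv f ρ) = conv f (partialDeriv i ρ) := by
  funext x
  have h := hc.hasFDerivAt_convolution_right (ContinuousLinearMap.mul ℝ ℝ) (μ := volume) hf
    (hρ.of_le (by exact_mod_cast le_top)) x
  have hex : ConvolutionExistsAt f (fderiv ℝ ρ) x
      ((ContinuousLinearMap.mul ℝ ℝ).precompR (Eucl N)) volume :=
    (hc.fderiv ℝ).convolutionExists_right _ hf (hρ.continuous_fderiv (by simp)) x
  simp only [partialDeriv, conv]
  rw [h.fderiv]
  unfold convolution
  rw [ContinuousLinearMap.integral_apply hex]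
  rfl

theorem contDiff_conv {f ρ : Eucl N → ℝ} (hf : LocallyIntegrable f)
    (hρ : ContDiff ℝ ∞ ρ) (hc : HasCompactSupport ρ) : ContDiff ℝ ∞ (conv f ρ) :=
  hc.contDiff_convolution_right _ hf hρ

theorem multiDeriv_conv {f ρ : Eucl N → ℝ} (hf : LocallyIntegrable f)
    (hρ : ContDiff ℝ ∞ ρ) (hc : HasCompactSupport ρ) (α : Fin N → ℕ) :
    multiDeriv α (conv f ρ) = conv f (multiDeriv α ρ) :=
  (multiDeriv_induction (R := fun g h => ContDiff ℝ ∞ h ∧ HasCompactSupport h ∧ g = conv f h)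
    (fun i g h H => ⟨H.1.partialDeriv i, H.2.1.of_isClosed_subset (isClosed_tsupport _)
      (tsupport_partialDeriv_subset h i), by rw [H.2.2, partialDeriv_conv hf H.1 H.2.1]⟩)
    α ⟨hρ, hc, rfl⟩).2.2

/-- Translations are continuous in `L²`. -/
theorem MeasureTheory.MemLp.exists_eLpNorm_translate_sub_le {W : Eucl N → ℝ} (hW : MemLp W 2)
    {ε : ℝ≥0∞} (hε : ε ≠ 0) :
    ∃ τ > 0, ∀ y : Eucl N, ‖y‖ < τ → eLpNorm (fun x => W (x - y) - W x) 2 ≤ ε := by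
  have : Fact ((2 : ℝ≥0∞) ≠ ⊤) := ⟨by norm_num⟩
  -- Translation is an additive domain action on `Lp`, continuous because the exponent is finite.
  have hcont : Continuous fun y : Eucl N => DomAddAct.mk (-y) +ᵥ hW.toLp W := by
    have : Continuous fun y : Eucl N => DomAddAct.mk (-y) :=
      DomAddAct.continuous_mk.comp continuous_neg
    exact this.vadd continuous_const
  have h0 := hcont.tendsto 0
  have hlim : ∀ᶠ y : Eucl N in nhds 0,
      edist (DomAddAct.mk (-y) +ᵥ hW.toLp W) (hW.toLp W) < ε := by
    have := EMetric.tendsto_nhds.1 h0 ε (pos_iff_ne_zero.2 hε)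
    simpa using this
  obtain ⟨τ, hτ, H⟩ := Metric.eventually_nhds_iff.1 hlim
  refine ⟨τ, hτ, fun y hy => ?_⟩
  have h1 := (H (by simpa using hy)).le
  rw [DomAddAct.mk_vadd_toLp, Lp.edist_toLp_toLp] at h1
  refine le_trans (le_of_eq (congrArg (fun f => eLpNorm f 2 volume) ?_)) h1
  funext x
  simp [sub_eq_neg_add]

/-- A mollifier which is concentrated near the origin. -/
structure IsMollifier (τ : ℝ) (ρ : Eucl N → ℝ) : Prop where
  contDiff : ContDiff ℝ ∞ ρ
  nonneg : ∀ x, 0 ≤ ρ x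
  integral_eq : ∫ x, ρ x = 1
  tsupport_subset : tsupport ρ ⊆ Metric.ball 0 τ

theorem IsMollifier.hasCompactSupport {τ : ℝ} {ρ : Eucl N → ℝ} (h : IsMollifier τ ρ) :
    HasCompactSupport ρ :=
  (isCompact_closedBall (0 : Eucl N) τ).of_isClosed_subset (isClosed_tsupport _)
    (h.tsupport_subset.trans Metric.ball_subset_closedBall)

theorem eLpNorm_two_sq {α : Type*} [MeasurableSpace α] (μ : Measure α) (g : α → ℝ) :
    eLpNorm g 2 μ ^ 2 = ∫⁻ x, ‖g x‖ₑ ^ 2 ∂μ := by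
  rw [eLpNorm_eq_lintegral_rpow_enorm_toReal (by norm_num) (by norm_num)]
  rw [← ENNReal.rpow_natCast, ← ENNReal.rpow_mul]
  simp

/-- `ρ dy` is a probability measure, and the error at `x` is the mean of `W (x - y) - W x`. Its
square is at most the mean square, by monotonicity of `L^p` norms on a probability space; Tonelli
then reduces to translations shorter than `τ`. Strong measurability of `W` gives joint measurability
in `(x, y)`. -/
theorem eLpNorm_conv_sub_le {W ρ : Eucl N → ℝ} (hWm : StronglyMeasurable W) (hW : MemLp W 2)
    {τ : ℝ} (hρ : IsMollifier τ ρ) {ε : ℝ≥0∞}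
    (hτ : ∀ y : Eucl N, ‖y‖ < τ → eLpNorm (fun x => W (x - y) - W x) 2 ≤ ε) :
    eLpNorm (fun x => conv W ρ x - W x) 2 ≤ ε := by
  have hρi : Integrable ρ := hρ.contDiff.continuous.integrable_of_hasCompactSupport
    hρ.hasCompactSupport
  have hρm : Measurable fun y => ENNReal.ofReal (ρ y) :=
    hρ.contDiff.continuous.measurable.ennreal_ofReal
  set P : Measure (Eucl N) := volume.withDensity fun y => ENNReal.ofReal (ρ y) with hP
  have hPprob : IsProbabilityMeasure P := by
    constructor
    rw [hP, withDensity_apply _ MeasurableSet.univ, Measure.restrict_univ,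
      ← ofReal_integral_eq_lintegral_ofReal hρi (Filter.Eventually.of_forall hρ.nonneg),
      hρ.integral_eq, ENNReal.ofReal_one]
  have hsub : Measurable fun p : Eucl N × Eucl N => W (p.1 - p.2) - W p.1 :=
    (hWm.measurable.comp (measurable_fst.sub measurable_snd)).sub
      (hWm.measurable.comp measurable_fst)
  have hPint : ∀ g : Eucl N → ℝ, ∫ y, g y ∂P = ∫ y, g y * ρ y := by
    intro g
    rw [hP, integral_withDensity_eq_integral_toReal_smul hρm
      (Filter.Eventually.of_forall fun _ => ENNReal.ofReal_lt_top)]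
    refine integral_congr_ae (Filter.Eventually.of_forall fun y => ?_)
    simp only [smul_eq_mul, ENNReal.toReal_ofReal (hρ.nonneg y)]
    ring
  have hWl : LocallyIntegrable W := hW.locallyIntegrable (by norm_num)
  have hpt : ∀ x, ‖conv W ρ x - W x‖ₑ ^ 2 ≤ ∫⁻ y, ‖W (x - y) - W x‖ₑ ^ 2 ∂P := by
    intro x
    have hint : Integrable (fun y => W (x - y)) P := by
      rw [hP, integrable_withDensity_iff_integrable_smul' hρm
        (Filter.Eventually.of_forall fun _ => ENNReal.ofReal_lt_top)]
      have := (hρ.hasCompactSupport.convolutionExists_right (ContinuousLinearMap.mul ℝ ℝ) hWl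
        hρ.contDiff.continuous x).integrable_swap
      refine this.congr (Filter.Eventually.of_forall fun y => ?_)
      simp only [smul_eq_mul, ENNReal.toReal_ofReal (hρ.nonneg y), ContinuousLinearMap.mul_apply']
      ring
    have e1 : conv W ρ x - W x = ∫ y, (W (x - y) - W x) ∂P := by
      rw [integral_sub hint (integrable_const _), hPint, conv_apply_swap]
      simp
    have hm : AEStronglyMeasurable (fun y => W (x - y) - W x) P :=
      (hsub.comp measurable_prodMk_left).aestronglyMeasurable
    have e2 : ‖conv W ρ x - W x‖ₑ ≤ eLpNorm (fun y => W (x - y) - W x) 2 P := by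
      rw [e1]
      refine (enorm_integral_le_lintegral_enorm _).trans ?_
      rw [← eLpNorm_one_eq_lintegral_enorm]
      exact eLpNorm_le_eLpNorm_of_exponent_le (by norm_num) hm
    refine (pow_le_pow_left' e2 2).trans (le_of_eq ?_)
    rw [eLpNorm_two_sq]
  have hball : ∀ᵐ y ∂P, ‖y‖ < τ := by
    rw [hP, ae_withDensity_iff hρm]
    refine Filter.Eventually.of_forall fun y hy => ?_
    have : y ∈ tsupport ρ := subset_tsupport _ fun h => hy (by simp [h])
    simpa using hρ.tsupport_subset this
  refine (ENNReal.pow_le_pow_left_iff two_ne_zero).1 ?_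
  calc eLpNorm (fun x => conv W ρ x - W x) 2 volume ^ 2
      = ∫⁻ x, ‖conv W ρ x - W x‖ₑ ^ 2 := eLpNorm_two_sq _ _
    _ ≤ ∫⁻ x, ∫⁻ y, ‖W (x - y) - W x‖ₑ ^ 2 ∂P := lintegral_mono hpt
    _ = ∫⁻ y, (∫⁻ x, ‖W (x - y) - W x‖ₑ ^ 2) ∂P := by
        refine lintegral_lintegral_swap ?_
        exact (hsub.enorm.pow_const 2).aemeasurable
    _ ≤ ∫⁻ y, ε ^ 2 ∂P := by
        refine lintegral_mono_ae (μ := P) ?_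
        filter_upwards [hball] with y hy
        rw [← eLpNorm_two_sq]
        exact pow_le_pow_left' (hτ y hy) 2
    _ = ε ^ 2 := by simp

/-- Mollification converges in `L²`, uniformly in the mollifier. -/
theorem MeasureTheory.MemLp.exists_eLpNorm_conv_sub_le {W : Eucl N → ℝ} (hW : MemLp W 2)
    {ε : ℝ≥0∞} (hε : ε ≠ 0) :
    ∃ τ > 0, ∀ τ' ≤ τ, ∀ ρ, IsMollifier τ' ρ → eLpNorm (fun x => conv W ρ x - W x) 2 ≤ ε := by
  -- A strongly measurable representative has the same convolutions.
  obtain ⟨V, hVm, hWV⟩ := hW.1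
  have hV : MemLp V 2 := (memLp_congr_ae hWV).1 hW
  obtain ⟨τ, hτ, H⟩ := hV.exists_eLpNorm_translate_sub_le hε
  refine ⟨τ, hτ, fun τ' hτ' ρ hρ => ?_⟩
  refine le_trans (le_of_eq (eLpNorm_congr_ae ?_))
    (eLpNorm_conv_sub_le hVm hV hρ fun y hy => H y (hy.trans_le hτ'))
  filter_upwards [hWV] with x hx
  rw [hx]
  congr 1
  rw [conv_apply, conv_apply]
  refine integral_congr_ae ?_
  filter_upwards [hWV] with z hz
  rw [hz]

end Convolutions

/-! ### Smooth functions are dense in Sobolev spaces of Lipschitz domains -/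

section Density

open MeasureTheory
open scoped ENNReal Manifold

variable {N : ℕ}

/-- There are mollifiers which are supported near a given point. -/
theorem exists_smooth_bump (c : Eucl N) {δ : ℝ} (hδ : 0 < δ) :
    ∃ ρ : Eucl N → ℝ, ContDiff ℝ ∞ ρ ∧ (∀ x, 0 ≤ ρ x) ∧ ∫ x, ρ x = 1 ∧
      tsupport ρ ⊆ Metric.closedBall c δ := by
  let b : ContDiffBump c := ⟨δ / 2, δ, by positivity, by linarith⟩
  exact ⟨b.normed volume, b.contDiff_normed, b.nonneg_normed, b.integral_normed,
    b.tsupport_normed_eq.le⟩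

/-- There are smooth cutoff functions for a compact set in an open set. -/
theorem exists_smooth_cutoff {K V : Set (Eucl N)} (hK : IsCompact K) (hV : IsOpen V)
    (hKV : K ⊆ V) : ∃ χ : Eucl N → ℝ, ContDiff ℝ ∞ χ ∧ HasCompactSupport χ ∧ tsupport χ ⊆ V ∧
      ∀ x ∈ K, ∀ᶠ y in nhds x, χ y = 1 := by
  obtain ⟨L, hL, hKL, hLV⟩ := exists_compact_between hK hV hKV
  obtain ⟨χ, h1, h0, -⟩ := exists_contMDiffMap_one_nhds_of_subset_interior (n := (⊤ : ℕ∞))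
    (𝓘(ℝ, Eucl N)) hK.isClosed hKL
  have hsub : tsupport χ ⊆ L := closure_minimal (fun x hx => by
    by_contra h
    exact hx (h0 x h)) hL.isClosed
  refine ⟨χ, χ.contMDiff.contDiff, hL.of_isClosed_subset (isClosed_tsupport _) hsub,
    hsub.trans hLV, fun x hx => ?_⟩
  exact (mem_nhdsSet_iff_forall.1 h1) x hx

/-- There are arbitrarily concentrated mollifiers which, on `V`, only use values from inside `U`
at points of `U`. -/
def HasInwardMollifiers (U V : Set (Eucl N)) : Prop :=
  ∀ τ > 0, ∃ ρ, IsMollifier τ ρ ∧ ∀ x ∈ U, ∀ z ∈ V, x - z ∈ tsupport ρ → z ∈ U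

theorem HasInwardMollifiers.of_subset {U V : Set (Eucl N)} (h : V ⊆ U) :
    HasInwardMollifiers U V := by
  intro τ hτ
  obtain ⟨ρ, h1, h2, h3, h4⟩ := exists_smooth_bump (0 : Eucl N) (half_pos hτ)
  exact ⟨ρ, ⟨h1, h2, h3, h4.trans (Metric.closedBall_subset_ball (by linarith))⟩,
    fun x _ z hz _ => h hz⟩

/-- The mollifier is centred at `-t e`, so it reads `z = x + t e - w` with `‖w‖ ≤ δ`. The height
grows by at least `t - δ`, the graph by at most `2 L δ`, and these are equal by the choice of `δ`;
strictness is inherited from `x ∈ U`. -/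
theorem HasInwardMollifiers.of_lipschitz_graph {U : Set (Eucl N)} {p e : Eucl N} {r : ℝ}
    (hr : 0 < r) (he : ‖e‖ = 1) {γ : Eucl N → ℝ} {L : NNReal}
    (hγ : LipschitzOnWith L γ {y | ⟪e, y⟫ = 0})
    (hU : ∀ x ∈ Metric.ball p r, x ∈ U ↔ γ (x - ⟪e, x⟫ • e) < ⟪e, x⟫) :
    HasInwardMollifiers U (Metric.ball p (r / 2)) := by
  intro τ hτ
  -- The support has norms at most `t + δ ≤ 2 t < τ`, and `z` in the half ball puts `x` in the full
  -- ball because `2 t ≤ r / 2`.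
  set t : ℝ := min τ r / 4 with ht
  have ht0 : 0 < t := by positivity
  have htτ : 4 * t ≤ τ := by linarith [min_le_left τ r]
  have htr : 4 * t ≤ r := by linarith [min_le_right τ r]
  set δ : ℝ := t / (2 * L + 1) with hδ
  have hL : (0 : ℝ) ≤ L := L.2
  have hδ0 : 0 < δ := by positivity
  have hδt : δ * (2 * L + 1) = t := div_mul_cancel₀ _ (by positivity)
  have hδt' : δ ≤ t := by nlinarith
  obtain ⟨ρ, h1, h2, h3, h4⟩ := exists_smooth_bump (-(t • e)) hδ0
  have hte : ‖t • e‖ = t := by rw [norm_smul, he, mul_one, Real.norm_of_nonneg ht0.le]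
  refine ⟨ρ, ⟨h1, h2, h3, fun y hy => ?_⟩, fun x hx z hz hxz => ?_⟩
  · have := h4 hy
    rw [mem_closedBall_iff_norm, sub_neg_eq_add] at this
    rw [mem_ball_zero_iff]
    have h5 : ‖y‖ ≤ ‖y + t • e‖ + ‖t • e‖ := by simpa using norm_sub_le (y + t • e) (t • e)
    linarith
  · have hw := h4 hxz
    rw [mem_closedBall_iff_norm, sub_neg_eq_add] at hw
    set w := x - z + t • e with hwdef
    have hz' : z = x + t • e - w := by rw [hwdef]; abel
    have hproj : ∀ y : Eucl N, ⟪e, y - ⟪e, y⟫ • e⟫ = 0 := by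
      intro y
      rw [inner_sub_right, inner_smul_right, real_inner_self_eq_norm_sq, he]
      ring
    have hzr : ‖z - p‖ < r / 2 := mem_ball_iff_norm.1 hz
    have hxr : x ∈ Metric.ball p r := by
      rw [mem_ball_iff_norm]
      have e1 : x - p = (z - p) + (w - t • e) := by rw [hwdef]; abel
      rw [e1]
      have := norm_add_le (z - p) (w - t • e)
      have := norm_sub_le w (t • e)
      linarith
    have hzb : z ∈ Metric.ball p r := by
      rw [mem_ball_iff_norm]
      linarith
    rw [hU z hzb]
    have hγx := (hU x hxr).1 hx
    have hlip := hγ.dist_le_mul _ (hproj z) _ (hproj x)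
    have hez : ⟪e, z⟫ = ⟪e, x⟫ + t - ⟪e, w⟫ := by
      rw [hz', inner_sub_right, inner_add_right, inner_smul_right, real_inner_self_eq_norm_sq, he]
      ring
    have hdiff : z - ⟪e, z⟫ • e - (x - ⟪e, x⟫ • e) = ⟪e, w⟫ • e - w := by
      rw [hez, hz']
      module
    have hew : |⟪e, w⟫| ≤ δ := by
      have := abs_real_inner_le_norm e w
      rw [he, one_mul] at this
      exact this.trans hw
    rw [Real.dist_eq, dist_eq_norm, hdiff] at hlip
    have hn : ‖⟪e, w⟫ • e - w‖ ≤ 2 * δ := by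
      have := norm_sub_le (⟪e, w⟫ • e) w
      rw [norm_smul, he, mul_one, Real.norm_eq_abs] at this
      linarith
    have h6 := (abs_le.1 hlip).2
    have h7 : (L : ℝ) * ‖⟪e, w⟫ • e - w‖ ≤ L * (2 * δ) := mul_le_mul_of_nonneg_left hn hL
    have h8 := (abs_le.1 hew).2
    nlinarith

/-- The smooth function `g` is `ε`-close to `f` in `H^k(U)`, in each derivative separately. -/
def SobolevClose (k : ℕ) (U : Set (Eucl N)) (ε : ℝ≥0∞) (f g : Eucl N → ℝ) : Prop :=
  ∀ α : Fin N → ℕ, ∑ i, α i ≤ k → ∃ h, HasWeakDeriv U α f h ∧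
    MemLp h 2 (volume.restrict U) ∧
    eLpNorm (fun x => multiDeriv α g x - h x) 2 (volume.restrict U) ≤ ε

theorem SobolevClose.add {k : ℕ} {U : Set (Eucl N)} {ε₁ ε₂ : ℝ≥0∞} {f₁ f₂ g₁ g₂ : Eucl N → ℝ}
    (h₁ : SobolevClose k U ε₁ f₁ g₁) (h₂ : SobolevClose k U ε₂ f₂ g₂)
    (hg₁ : ContDiff ℝ ∞ g₁) (hg₂ : ContDiff ℝ ∞ g₂) :
    SobolevClose k U (ε₁ + ε₂) (fun x => f₁ x + f₂ x) (fun x => g₁ x + g₂ x) := by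
  intro α hα
  obtain ⟨u₁, hu₁, hL₁, he₁⟩ := h₁ α hα
  obtain ⟨u₂, hu₂, hL₂, he₂⟩ := h₂ α hα
  refine ⟨_, hu₁.add hu₂, hL₁.add hL₂, ?_⟩
  have e : (fun x => multiDeriv α (fun x => g₁ x + g₂ x) x - (u₁ x + u₂ x)) =
      (fun x => multiDeriv α g₁ x - u₁ x) + (fun x => multiDeriv α g₂ x - u₂ x) := by
    funext x
    rw [multiDeriv_add hg₁ hg₂, Pi.add_apply]
    ring
  rw [e]
  exact (eLpNorm_add_le ((hg₁.multiDeriv α).continuous.aestronglyMeasurable.sub hL₁.1)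
    ((hg₂.multiDeriv α).continuous.aestronglyMeasurable.sub hL₂.1) (by norm_num)).trans
    (add_le_add he₁ he₂)

theorem exists_sobolevClose_sum {ι : Type*} {k : ℕ} {U : Set (Eucl N)} (s : Finset ι)
    (F : ι → Eucl N → ℝ)
    (hF : ∀ j ∈ s, ∀ ε : ℝ≥0∞, ε ≠ 0 → ∃ g, ContDiff ℝ ∞ g ∧ SobolevClose k U ε (F j) g)
    {ε : ℝ≥0∞} (hε : ε ≠ 0) :
    ∃ g, ContDiff ℝ ∞ g ∧ SobolevClose k U ε (fun x => ∑ j ∈ s, F j x) g := by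
  classical
  induction s using Finset.induction_on generalizing ε with
  | empty =>
    refine ⟨fun _ => 0, contDiff_const, fun α _ => ?_⟩
    refine ⟨multiDeriv α fun _ => 0, ?_, ?_, by simp⟩
    · simpa using (contDiff_const (c := (0 : ℝ))).hasWeakDeriv U α
    · have : multiDeriv α (fun _ : Eucl N => (0 : ℝ)) = fun _ => 0 :=
        multiDeriv_induction_pred (P := fun g => g = fun _ => 0)
          (fun i g hg => by subst hg; funext x; simp [partialDeriv]) α rfl
      rw [this]
      exact MemLp.zero'
  | insert a s ha ih =>
    have hε2 : ε / 2 ≠ 0 := (ENNReal.half_pos hε).ne'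
    obtain ⟨g₁, hg₁, h₁⟩ := hF a (Finset.mem_insert_self a s) _ hε2
    obtain ⟨g₂, hg₂, h₂⟩ := ih (fun j hj => hF j (Finset.mem_insert_of_mem hj)) hε2
    refine ⟨fun x => g₁ x + g₂ x, hg₁.add hg₂, ?_⟩
    simp only [Finset.sum_insert ha]
    have := h₁.add h₂ hg₁ hg₂
    rwa [ENNReal.add_halves] at this

/-- The sign cancels the one in `HasWeakDeriv` when `ρ (x - ·)` enters a test function. -/
theorem multiDeriv_comp_sub_left {ρ : Eucl N → ℝ} (hρ : ContDiff ℝ ∞ ρ) (x : Eucl N)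
    (α : Fin N → ℕ) : multiDeriv α (fun z => ρ (x - z)) =
      fun z => (-1) ^ (∑ i, α i) * multiDeriv α ρ (x - z) := by
  induction α using multiIndex_induction with
  | zero => simp [multiDeriv_zero]
  | step α i ih =>
    have hs : ContDiff ℝ ∞ fun z => ρ (x - z) := hρ.comp (contDiff_const.sub contDiff_id)
    rw [multiDeriv_add_single hs, ih, multiDeriv_add_single hρ, sum_add_single]
    funext z
    have hd : DifferentiableAt ℝ (multiDeriv α ρ) (x - z) :=
      (hρ.multiDeriv α).differentiable (by simp) _
    have h1 : HasFDerivAt (fun z => multiDeriv α ρ (x - z))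
        ((fderiv ℝ (multiDeriv α ρ) (x - z)).comp (-ContinuousLinearMap.id ℝ (Eucl N))) z := by
      refine HasFDerivAt.comp (f := fun z => x - z) z hd.hasFDerivAt ?_
      exact (hasFDerivAt_id z).const_sub x
    simp only [partialDeriv]
    rw [(h1.const_mul _).fderiv]
    simp [pow_succ]

/-- A function in `H^k(U)` which is supported where there are inward mollifiers can be
approximated by smooth functions. -/
theorem MemSobolev.exists_sobolevClose_mul {k : ℕ} {U V : Set (Eucl N)} (hU : IsOpen U)
    (hV : IsOpen V) (hUV : HasInwardMollifiers U V) {f φ : Eucl N → ℝ} (hf : MemSobolev k U f)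
    (hφ : ContDiff ℝ ∞ φ) (hc : HasCompactSupport φ) (hφV : tsupport φ ⊆ V) {ε : ℝ≥0∞}
    (hε : ε ≠ 0) : ∃ g, ContDiff ℝ ∞ g ∧ SobolevClose k U ε (fun x => φ x * f x) g := by
  -- Inwardness holds only at points of `V`. The cutoff `χ` confines test functions to `V`, and
  -- being `1` near the support of `φ` it is invisible to `u = φ f`.
  obtain ⟨χ, hχ, hχc, hχV, hχ1⟩ := exists_smooth_cutoff hc hV hφV
  have hu := hf.mul_smooth hφ hc
  set u := fun x => φ x * f x with hudef
  have hloc : ∀ (α : Fin N → ℕ) (ψ : Eucl N → ℝ) (z : Eucl N),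
      u z * multiDeriv α (fun y => χ y * ψ y) z = u z * multiDeriv α ψ z := by
    intro α ψ z
    by_cases hz : z ∈ tsupport φ
    · obtain ⟨O, hO1, hO, hzO⟩ := eventually_nhds_iff.1 (hχ1 z hz)
      have : Set.EqOn (fun y => χ y * ψ y) ψ O := fun y hy => by simp [hO1 y hy]
      rw [this.multiDeriv hO α hzO]
    · simp [hudef, image_eq_zero_of_notMem_tsupport hz]
  choose! v hv hvL using hu.2
  have hwL : ∀ α, ∑ i, α i ≤ k → MemLp (fun x => χ x * v α x) 2 (volume.restrict U) :=
    fun α hα => (hvL α hα).mul (p := ⊤) (hχ.continuous.memLp_top_of_hasCompactSupport hχc _)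
  have hw : ∀ α, ∑ i, α i ≤ k → HasWeakDeriv U α u (fun x => χ x * v α x) := by
    intro α hα
    refine ⟨(hv α hα).1, (hwL α hα).locallyIntegrableOn, fun η hη hηc hs => ?_⟩
    have := (hv α hα).2.2 (fun y => χ y * η y) (hχ.mul hη) hηc.mul_left
      (tsupport_mul_subset_right.trans hs)
    simp only [hloc] at this
    rw [this]
    congr 2
    ext x
    ring
  have hWL : ∀ α, ∑ i, α i ≤ k → MemLp (U.indicator fun x => χ x * v α x) 2 volume :=
    fun α hα => (memLp_indicator_iff_restrict hU.measurableSet).2 (hwL α hα)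
  have huL : MemLp (U.indicator u) 2 volume :=
    (memLp_indicator_iff_restrict hU.measurableSet).2 hu.1
  have hulI : LocallyIntegrable (U.indicator u) := huL.locallyIntegrable (by norm_num)
  -- There are finitely many `α`, hence one `τ` for all.
  have hτ : ∃ τ > 0, ∀ α ∈ multiIndices N k, ∀ ρ, IsMollifier τ ρ →
      eLpNorm (fun x => conv (U.indicator fun x => χ x * v α x) ρ x -
        U.indicator (fun x => χ x * v α x) x) 2 ≤ ε := by
    have : ∀ᶠ τ : ℝ in nhdsWithin 0 (Set.Ioi 0), ∀ α ∈ multiIndices N k, ∀ ρ, IsMollifier τ ρ →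
        eLpNorm (fun x => conv (U.indicator fun x => χ x * v α x) ρ x -
          U.indicator (fun x => χ x * v α x) x) 2 ≤ ε := by
      rw [Filter.eventually_all_finset]
      intro α hα
      obtain ⟨τ, hτ, H⟩ := (hWL α ((mem_multiIndices α).1 hα)).exists_eLpNorm_conv_sub_le hε
      filter_upwards [Ioc_mem_nhdsGT hτ] with τ' hτ'
      exact H τ' hτ'.2
    obtain ⟨τ, h1, h2⟩ := (this.and self_mem_nhdsWithin).exists
    exact ⟨τ, h2, h1⟩
  obtain ⟨τ, hτ0, hτ⟩ := hτ
  obtain ⟨ρ, hρ, hin⟩ := hUV τ hτ0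
  refine ⟨conv (U.indicator u) ρ, contDiff_conv hulI hρ.contDiff hρ.hasCompactSupport,
    fun α hα => ⟨_, hw α hα, hwL α hα, ?_⟩⟩
  refine le_trans ?_ ((eLpNorm_mono_measure _
    (Measure.restrict_le_self (s := U))).trans
    (hτ α ((mem_multiIndices α).2 hα) ρ hρ))
  refine le_of_eq (eLpNorm_congr_ae ?_)
  rw [Filter.EventuallyEq, ae_restrict_iff' hU.measurableSet]
  refine Filter.Eventually.of_forall fun x hx => ?_
  rw [Set.indicator_of_mem hx, multiDeriv_conv hulI hρ.contDiff hρ.hasCompactSupport]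
  congr 1
  have hind : ∀ F G : Eucl N → ℝ, conv (U.indicator F) G x = ∫ z in U, F z * G (x - z) := by
    intro F G
    rw [conv_apply, ← integral_indicator hU.measurableSet]
    congr 1
    ext z
    by_cases hz : z ∈ U <;> simp [hz]
  rw [hind, hind]
  have hψ : ContDiff ℝ ∞ fun z => ρ (x - z) := hρ.contDiff.comp (contDiff_const.sub contDiff_id)
  -- For each fixed `x ∈ U`, inwardness makes this an admissible test function; the weak identity
  -- then reads `D^α (u ∗ ρ) = (χ v_α) ∗ ρ` at `x`, both factors extended by zero off `U`.
  have hψt : tsupport (fun z => χ z * ρ (x - z)) ⊆ U := by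
    intro z hz
    refine hin x hx z (hχV (tsupport_mul_subset_left hz)) ?_
    exact tsupport_comp_subset_preimage ρ (f := fun z => x - z) (by fun_prop)
      (tsupport_mul_subset_right hz)
  have key := (hv α hα).2.2 (fun z => χ z * ρ (x - z)) (hχ.mul hψ) hχc.mul_right hψt
  simp only [hloc, multiDeriv_comp_sub_left hρ.contDiff] at key
  have e1 : ∫ z in U, u z * ((-1) ^ (∑ i, α i) * multiDeriv α ρ (x - z)) =
      (-1) ^ (∑ i, α i) * ∫ z in U, u z * multiDeriv α ρ (x - z) := by
    rw [← integral_const_mul]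
    congr 1
    ext z
    ring
  rw [e1] at key
  rw [mul_left_cancel₀ (pow_ne_zero _ (by norm_num)) key]
  congr 1
  ext z
  ring

/-- **Density of smooth functions** in the Sobolev space of a bounded Lipschitz domain. -/
theorem MemSobolev.exists_sobolevClose {k : ℕ} {U : Set (Eucl N)} (hU : IsOpen U)
    (hUc : IsCompact (closure U)) (hL : HasLipschitzBoundary U) {f : Eucl N → ℝ}
    (hf : MemSobolev k U f) {ε : ℝ≥0∞} (hε : ε ≠ 0) :
    ∃ g, ContDiff ℝ ∞ g ∧ SobolevClose k U ε f g := by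
  have hloc : ∀ p ∈ closure U, ∃ r > 0, HasInwardMollifiers U (Metric.ball p r) := by
    intro p hp
    by_cases hpU : p ∈ U
    · obtain ⟨r, hr, h⟩ := Metric.isOpen_iff.1 hU p hpU
      exact ⟨r, hr, .of_subset h⟩
    · obtain ⟨r, hr, e, he, γ, L, hγ, h⟩ := hL p ⟨hp, by rwa [hU.interior_eq]⟩
      exact ⟨r / 2, half_pos hr, .of_lipschitz_graph hr he hγ h⟩
  choose! r hr hin using hloc
  obtain ⟨t, htU, hcov⟩ := hUc.elim_nhds_subcover (fun p => Metric.ball p (r p))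
    fun p hp => Metric.ball_mem_nhds p (hr p hp)
  obtain ⟨φ, hφ⟩ := SmoothPartitionOfUnity.exists_isSubordinate (𝓘(ℝ, Eucl N)) (s := closure U)
    isClosed_closure (fun p : t => Metric.ball (p : Eucl N) (r p)) (fun _ => Metric.isOpen_ball)
    (fun x hx => by simpa using hcov hx)
  obtain ⟨g, hg, hclose⟩ := exists_sobolevClose_sum (k := k) (U := U) Finset.univ
    (fun (j : t) x => φ j x * f x) (fun j _ δ hδ =>
      hf.exists_sobolevClose_mul hU Metric.isOpen_ball (hin j (htU j j.2))
        (φ j).contMDiff.contDiff ((isCompact_closedBall (j : Eucl N) (r j)).of_isClosed_subset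
          (isClosed_tsupport _) ((hφ j).trans Metric.ball_subset_closedBall)) (hφ j) hδ) hε
  refine ⟨g, hg, fun α hα => ?_⟩
  obtain ⟨h, h1, h2, h3⟩ := hclose α hα
  refine ⟨h, h1.congr_left hU fun x hx => ?_, h2, h3⟩
  have := φ.sum_eq_one (subset_closure hx)
  rw [finsum_eq_sum_of_fintype] at this
  simp only
  rw [← Finset.sum_mul, this, one_mul]

end Density

/-! ### Approximation by trigonometric polynomials -/

section Trigonometric

open MeasureTheory Filter Topology

variable {N : ℕ}

/-- Real trigonometric polynomials with integer frequencies. -/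
def IsTrigPoly (g : Eucl N → ℝ) : Prop :=
  ∃ (ι : Type) (s : Finset ι) (ν : ι → Fin N → ℤ) (c : ι → ℂ),
    ∀ x, g x = (∑ j ∈ s, c j * Complex.exp (Complex.I * ∑ i, (ν j i : ℂ) * (x i : ℂ))).re

theorem IsTrigPoly.contDiff {g : Eucl N → ℝ} (hg : IsTrigPoly g) : ContDiff ℝ ∞ g := by
  obtain ⟨ι, s, ν, c, h⟩ := hg
  have hcoord : ∀ i : Fin N, ContDiff ℝ ∞ fun x : Eucl N => (x i : ℂ) := fun i =>
    Complex.ofRealCLM.contDiff.comp (EuclideanSpace.proj (𝕜 := ℝ) i).contDiff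
  rw [funext h]
  refine Complex.reCLM.contDiff.comp (ContDiff.sum fun j _ => contDiff_const.mul ?_)
  exact (contDiff_const.mul (ContDiff.sum fun i _ => contDiff_const.mul (hcoord i))).cexp

/-- The kernel `∏ i, ((1 + cos x_i) / 2)`, whose powers concentrate at `2πℤ^N`. -/
noncomputable def cosKernel (x : Eucl N) : ℝ := ∏ i, ((1 + Real.cos (x i)) / 2)

theorem continuous_cosKernel : Continuous (cosKernel (N := N)) :=
  continuous_finsetProd _ fun i _ => by fun_prop

theorem cosKernel_factor_nonneg (t : ℝ) : 0 ≤ (1 + Real.cos t) / 2 := by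
  linarith [Real.neg_one_le_cos t]

theorem cosKernel_factor_le_one (t : ℝ) : (1 + Real.cos t) / 2 ≤ 1 := by
  linarith [Real.cos_le_one t]

theorem cosKernel_nonneg (x : Eucl N) : 0 ≤ cosKernel x :=
  Finset.prod_nonneg fun _ _ => cosKernel_factor_nonneg _

theorem cosKernel_zero : cosKernel (0 : Eucl N) = 1 := by simp [cosKernel]

/-- The bound `2π` excludes the other peaks. It holds for the difference of an interior point and a
point of the cube, but can fail for points on opposite faces; hence the compact containment. -/
theorem cosKernel_lt_one {x : Eucl N} (hx : ∀ i, |x i| < 2 * Real.pi) (h0 : x ≠ 0) :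
    cosKernel x < 1 := by
  obtain ⟨i, hi⟩ : ∃ i, x i ≠ 0 := by
    by_contra! h
    exact h0 (by ext i; simpa using h i)
  have h1 : (1 + Real.cos (x i)) / 2 < 1 := by
    have hne : Real.cos (x i) ≠ 1 := fun h =>
      hi ((Real.cos_eq_one_iff_of_lt_of_lt (abs_lt.1 (hx i)).1 (abs_lt.1 (hx i)).2).1 h)
    linarith [lt_of_le_of_ne (Real.cos_le_one (x i)) hne]
  rw [cosKernel, ← Finset.mul_prod_erase _ _ (Finset.mem_univ i)]
  refine lt_of_le_of_lt (mul_le_of_le_one_right (cosKernel_factor_nonneg _) ?_) h1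
  exact Finset.prod_le_one (fun _ _ => cosKernel_factor_nonneg _)
    fun _ _ => cosKernel_factor_le_one _

theorem cube_eq_preimage : cube N = WithLp.ofLp ⁻¹'
    (Set.univ.pi fun _ : Fin N => Set.Icc 0 (2 * Real.pi)) := by
  ext x
  simp only [cube, Set.mem_ofPred_eq, Set.mem_preimage, Set.mem_univ_pi]

theorem isCompact_cube : IsCompact (cube N) := by
  rw [cube_eq_preimage]
  exact (PiLp.homeomorph 2 fun _ : Fin N => ℝ).isCompact_preimage.2
    (isCompact_univ_pi fun _ => isCompact_Icc)

theorem mem_Ioo_of_mem_interior_cube {x : Eucl N} (hx : x ∈ interior (cube N)) (i : Fin N) :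
    x i ∈ Set.Ioo 0 (2 * Real.pi) := by
  rw [← interior_Icc]
  have h : IsOpenMap fun f : Eucl N => f i := PiLp.isOpenMap_apply 2 (fun _ => ℝ) i
  refine interior_mono ?_ (h.image_interior_subset (cube N) ⟨x, hx, rfl⟩)
  rintro _ ⟨y, hy, rfl⟩
  exact hy i

/-- The integral of a translate of a power of the kernel does not depend on the translation. -/
theorem setIntegral_cosKernel_sub_pow (n : ℕ) (x : Eucl N) :
    ∫ y in cube N, cosKernel (x - y) ^ n =
      ∏ _i : Fin N, ∫ t in (0 : ℝ)..(2 * Real.pi), ((1 + Real.cos t) / 2) ^ n := by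
  have h1 := (PiLp.volume_preserving_ofLp (Fin N)).setIntegral_preimage_emb
    (MeasurableEquiv.toLp 2 (Fin N → ℝ)).symm.measurableEmbedding
    (fun y : Fin N → ℝ => ∏ i, ((1 + Real.cos (x i - y i)) / 2) ^ n)
    (Set.univ.pi fun _ : Fin N => Set.Icc 0 (2 * Real.pi))
  rw [← cube_eq_preimage] at h1
  have h2 : ∀ y : Eucl N, cosKernel (x - y) ^ n =
      ∏ i, ((1 + Real.cos (x i - y i)) / 2) ^ n := by
    intro y
    simp [cosKernel, Finset.prod_pow]
  simp only [h2]
  rw [h1, volume_pi, Measure.restrict_pi_pi,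
    integral_fintype_prod_eq_prod (fun i t => ((1 + Real.cos (x i - t)) / 2) ^ n)]
  refine Finset.prod_congr rfl fun i _ => ?_
  have hper : Function.Periodic (fun t => ((1 + Real.cos t) / 2) ^ n) (2 * Real.pi) := by
    intro t
    simp
  rw [integral_Icc_eq_integral_Ioc, ← intervalIntegral.integral_of_le Real.two_pi_pos.le,
    intervalIntegral.integral_comp_sub_left (fun t => ((1 + Real.cos t) / 2) ^ n)]
  have := hper.intervalIntegral_add_eq (x i - 2 * Real.pi) 0
  simpa using this

/-- The normalised powers of the kernel. -/
noncomputable def trigKernel (n : ℕ) (x : Eucl N) : ℝ :=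
  (∏ _i : Fin N, ∫ t in (0 : ℝ)..(2 * Real.pi), ((1 + Real.cos t) / 2) ^ n)⁻¹ * cosKernel x ^ n

theorem continuous_trigKernel (n : ℕ) : Continuous (trigKernel (N := N) n) :=
  continuous_const.mul (continuous_cosKernel.pow n)

theorem trigKernel_nonneg (n : ℕ) (x : Eucl N) : 0 ≤ trigKernel n x := by
  refine mul_nonneg (inv_nonneg.2 (Finset.prod_nonneg fun _ _ => ?_))
    (pow_nonneg (cosKernel_nonneg x) n)
  exact intervalIntegral.integral_nonneg Real.two_pi_pos.le
    fun t _ => pow_nonneg (cosKernel_factor_nonneg t) n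

/-- The inequality suffices for domination and holds even for `0⁻¹ = 0`, so the normalising integral
need not be shown nonzero. -/
theorem setIntegral_trigKernel_le_one (n : ℕ) (x : Eucl N) :
    ∫ y in cube N, trigKernel n (x - y) ≤ 1 := by
  simp only [trigKernel]
  rw [integral_const_mul, setIntegral_cosKernel_sub_pow]
  exact inv_mul_le_one

theorem conv_eq_setIntegral_cube {T ψ : Eucl N → ℝ} (hψ : tsupport ψ ⊆ cube N) (x : Eucl N) :
    conv T ψ x = ∫ y in cube N, T (x - y) * ψ y := by
  rw [conv_apply_swap]
  exact (setIntegral_eq_integral_of_forall_compl_eq_zero fun y hy => by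
    rw [image_eq_zero_of_notMem_tsupport fun h => hy (hψ h), mul_zero]).symm

/-- For `x` in the open cube, `y ↦ cosKernel (x - y)` has its unique maximum over the closed cube at
`y = x`, so its normalised powers form an approximate identity there. -/
theorem tendsto_conv_trigKernel {ψ : Eucl N → ℝ} (hψ : Continuous ψ)
    (hs : tsupport ψ ⊆ cube N) {x : Eucl N} (hx : x ∈ interior (cube N)) :
    Tendsto (fun n => conv (trigKernel n) ψ x) atTop (𝓝 (ψ x)) := by
  have h := tendsto_setIntegral_pow_smul_of_unique_maximum_of_isCompact_of_continuousOn
    (μ := volume) (x₀ := x) (g := ψ) (c := fun y => cosKernel (x - y)) isCompact_cube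
    (continuous_cosKernel.comp (continuous_const.sub continuous_id)).continuousOn
    (fun y hy hyx => by
      simp only [sub_self, cosKernel_zero]
      refine cosKernel_lt_one (fun i => ?_) (sub_ne_zero.2 hyx.symm)
      have h1 := mem_Ioo_of_mem_interior_cube hx i
      have h2 := hy i
      simp only [PiLp.sub_apply]
      rw [abs_lt]
      constructor <;> linarith [h1.1, h1.2, h2.1, h2.2])
    (fun y _ => cosKernel_nonneg _) (by simp [cosKernel_zero]) (subset_closure hx)
    hψ.continuousOn
  refine h.congr fun n => ?_
  rw [conv_eq_setIntegral_cube hs, setIntegral_cosKernel_sub_pow, smul_eq_mul,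
    ← integral_const_mul]
  simp only [trigKernel, smul_eq_mul, mul_assoc]

theorem norm_conv_trigKernel_le {ψ : Eucl N → ℝ} (hs : tsupport ψ ⊆ cube N) {C : ℝ}
    (hC : ∀ x, ‖ψ x‖ ≤ C) (n : ℕ) (x : Eucl N) : ‖conv (trigKernel n) ψ x‖ ≤ C := by
  have hC0 : 0 ≤ C := (norm_nonneg _).trans (hC 0)
  have hi : IntegrableOn (fun y => trigKernel n (x - y)) (cube N) :=
    ((continuous_trigKernel n).comp
      (continuous_const.sub continuous_id)).continuousOn.integrableOn_compact isCompact_cube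
  rw [conv_eq_setIntegral_cube hs]
  calc ‖∫ y in cube N, trigKernel n (x - y) * ψ y‖
      ≤ ∫ y in cube N, trigKernel n (x - y) * C := by
        refine norm_integral_le_of_norm_le (hi.mul_const C) (Eventually.of_forall fun y => ?_)
        rw [norm_mul, Real.norm_of_nonneg (trigKernel_nonneg n _)]
        exact mul_le_mul_of_nonneg_left (hC y) (trigKernel_nonneg n _)
    _ = (∫ y in cube N, trigKernel n (x - y)) * C := integral_mul_const _ _
    _ ≤ 1 * C := mul_le_mul_of_nonneg_right (setIntegral_trigKernel_le_one n x) hC0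
    _ = C := one_mul C

/-- With `z = e^{it}` one has `(1 + cos t) / 2 = (z + 1)² / (4 z)`; the binomial theorem gives the
frequencies `-n, …, n`. -/
theorem cosKernel_factor_pow (n : ℕ) (t : ℝ) : ((((1 + Real.cos t) / 2) ^ n : ℝ) : ℂ) =
    ∑ j ∈ Finset.range (2 * n + 1), ((2 * n).choose j : ℂ) / 4 ^ n *
      Complex.exp (Complex.I * (((j : ℤ) - n : ℤ) * t)) := by
  set z := Complex.exp (Complex.I * t) with hz
  have hz0 : z ≠ 0 := Complex.exp_ne_zero _
  have h1 : (((1 + Real.cos t) / 2 : ℝ) : ℂ) = (z + 1) ^ 2 * (4 * z)⁻¹ := by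
    have h2 : z⁻¹ = Complex.exp (-(t * Complex.I)) := by
      rw [hz, ← Complex.exp_neg, mul_comm]
    push_cast
    rw [Complex.cos, ← neg_mul_eq_neg_mul, ← h2, mul_comm (t : ℂ), ← hz]
    field_simp
    ring
  push_cast at h1 ⊢
  rw [h1, mul_pow, ← pow_mul, add_pow, Finset.sum_mul]
  refine Finset.sum_congr rfl fun j _ => ?_
  have h3 : Complex.exp (Complex.I * (((j : ℂ) - n) * t)) = z ^ j * (z ^ n)⁻¹ := by
    rw [hz, ← Complex.exp_nat_mul, ← Complex.exp_nat_mul, ← Complex.exp_neg, ← Complex.exp_add]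
    congr 1
    ring
  rw [h3, one_pow, inv_pow, mul_pow, mul_inv]
  ring

theorem exists_trigKernel_eq (n : ℕ) : ∃ (s : Finset (Fin N → ℕ)) (ν : (Fin N → ℕ) → Fin N → ℤ)
    (a : (Fin N → ℕ) → ℂ), ∀ x : Eucl N, (trigKernel n x : ℂ) =
      ∑ p ∈ s, a p * Complex.exp (Complex.I * ∑ i, (ν p i : ℂ) * (x i : ℂ)) := by
  refine ⟨Fintype.piFinset fun _ => Finset.range (2 * n + 1), fun p i => (p i : ℤ) - n,
    fun p => ((∏ _i : Fin N, ∫ t in (0 : ℝ)..(2 * Real.pi), ((1 + Real.cos t) / 2) ^ n)⁻¹ : ℝ) *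
      ∏ i, ((2 * n).choose (p i) : ℂ) / 4 ^ n, fun x => ?_⟩
  have h : ((cosKernel x ^ n : ℝ) : ℂ) = ∏ i, ((((1 + Real.cos (x i)) / 2) ^ n : ℝ) : ℂ) := by
    rw [cosKernel, ← Finset.prod_pow, Complex.ofReal_prod]
  rw [trigKernel, Complex.ofReal_mul, h]
  simp only [cosKernel_factor_pow, Finset.prod_univ_sum, mul_assoc]
  rw [Finset.mul_sum]
  refine Finset.sum_congr rfl fun p _ => ?_
  rw [Finset.prod_mul_distrib, Finset.mul_sum, Complex.exp_sum]

/-- Each character of `x - y` factors into one of `x` and one of `-y`; integrating out `y`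
multiplies each coefficient by a Fourier integral of `φ`. -/
theorem isTrigPoly_conv_trigKernel (n : ℕ) {φ : Eucl N → ℝ} (hφ : Continuous φ)
    (hc : HasCompactSupport φ) : IsTrigPoly (conv (trigKernel n) φ) := by
  obtain ⟨s, ν, a, h⟩ := exists_trigKernel_eq (N := N) n
  refine ⟨_, s, ν, fun p => a p *
    ∫ y, Complex.exp (-(Complex.I * ∑ i, (ν p i : ℂ) * (y i : ℂ))) * (φ y : ℂ), fun x => ?_⟩
  rw [conv_apply_swap, ← Complex.ofReal_re (∫ y, trigKernel n (x - y) * φ y)]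
  congr 1
  rw [← integral_complex_ofReal]
  have hpt : ∀ y : Eucl N, ((trigKernel n (x - y) * φ y : ℝ) : ℂ) = ∑ p ∈ s,
      a p * Complex.exp (Complex.I * ∑ i, (ν p i : ℂ) * (x i : ℂ)) *
        (Complex.exp (-(Complex.I * ∑ i, (ν p i : ℂ) * (y i : ℂ))) * (φ y : ℂ)) := by
    intro y
    rw [Complex.ofReal_mul, h, Finset.sum_mul]
    refine Finset.sum_congr rfl fun p _ => ?_
    rw [mul_assoc, mul_assoc, ← mul_assoc (Complex.exp _) (Complex.exp _), ← Complex.exp_add]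
    congr 3
    simp only [PiLp.sub_apply, Complex.ofReal_sub, mul_sub, Finset.sum_sub_distrib]
    ring
  simp only [hpt]
  have hcc : HasCompactSupport fun y => (φ y : ℂ) := hc.comp_left Complex.ofReal_zero
  rw [integral_finsetSum]
  · refine Finset.sum_congr rfl fun p _ => ?_
    rw [integral_const_mul]
    ring
  · intro p _
    refine Integrable.const_mul (Continuous.integrable_of_hasCompactSupport ?_ hcc.mul_left) _
    fun_prop

/-- Dominated convergence: the error tends to zero pointwise on `U`, is bounded by `2 C`, and `U`
has finite measure. -/
theorem eventually_eLpNorm_conv_trigKernel_sub_le {U : Set (Eucl N)}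
    (hUo : IsOpen U) (hU : U ⊆ interior (cube N)) {ψ : Eucl N → ℝ} (hψ : Continuous ψ)
    (hs : tsupport ψ ⊆ cube N) {ε : ENNReal} (hε : ε ≠ 0) : ∀ᶠ n in atTop,
      eLpNorm (fun x => conv (trigKernel n) ψ x - ψ x) 2 (volume.restrict U) ≤ ε := by
  have hc : HasCompactSupport ψ := isCompact_cube.of_isClosed_subset (isClosed_tsupport _) hs
  obtain ⟨C, hC⟩ := hc.exists_bound_of_continuous hψ
  have hfin : volume U ≠ ⊤ :=
    ((measure_mono (hU.trans interior_subset)).trans_lt isCompact_cube.measure_lt_top).ne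
  have hcont : ∀ n, Continuous (conv (trigKernel n) ψ) := fun n =>
    hc.continuous_convolution_right _ (continuous_trigKernel n).locallyIntegrable hψ
  have key := tendsto_lintegral_of_dominated_convergence (μ := volume.restrict U)
    (F := fun n x => ‖conv (trigKernel n) ψ x - ψ x‖ₑ ^ 2) (f := fun _ => 0)
    (fun _ => ENNReal.ofReal (C + C) ^ 2)
    (fun n => ((hcont n).sub hψ).measurable.enorm.pow_const 2)
    (fun n => Eventually.of_forall fun x => by
      refine pow_le_pow_left' ?_ 2
      rw [← ofReal_norm]
      exact ENNReal.ofReal_le_ofReal ((norm_sub_le _ _).trans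
        (add_le_add (norm_conv_trigKernel_le hs hC n x) (hC x))))
    (by
      rw [lintegral_const, Measure.restrict_apply_univ]
      exact ENNReal.mul_ne_top (by simp) hfin)
    (by
      rw [ae_restrict_iff' hUo.measurableSet]
      refine Eventually.of_forall fun x hx => ?_
      have h1 := (tendsto_conv_trigKernel hψ hs (hU hx)).sub_const (ψ x)
      rw [sub_self] at h1
      have h2 := (ENNReal.continuous_pow 2).tendsto _ |>.comp h1.enorm
      simpa [Function.comp_def] using h2)
  simp only [lintegral_zero] at key
  have hε2 : 0 < ε ^ 2 := pos_iff_ne_zero.2 (pow_ne_zero 2 hε)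
  filter_upwards [key.eventually_lt_const hε2] with n hn
  refine (ENNReal.pow_le_pow_left_iff two_ne_zero).1 ?_
  rw [eLpNorm_two_sq]
  exact hn.le

/-- Smooth functions can be approximated, with their derivatives, by trigonometric polynomials. -/
theorem exists_isTrigPoly_eLpNorm_le {U : Set (Eucl N)} (hUo : IsOpen U)
    (hU : CompactlyContained U (cube N)) {g : Eucl N → ℝ} (hg : ContDiff ℝ ∞ g) (k : ℕ)
    {ε : ENNReal} (hε : ε ≠ 0) : ∃ q, IsTrigPoly q ∧ ∀ α : Fin N → ℕ, ∑ i, α i ≤ k →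
      eLpNorm (fun x => multiDeriv α q x - multiDeriv α g x) 2
        (volume.restrict U) ≤ ε := by
  obtain ⟨χ, hχ, hχc, hχs, hχ1⟩ := exists_smooth_cutoff hU.1 isOpen_interior hU.2
  have hφ : ContDiff ℝ ∞ fun x => χ x * g x := hχ.mul hg
  have hφc : HasCompactSupport fun x => χ x * g x := hχc.mul_right
  have hs : ∀ α, tsupport (multiDeriv α fun x => χ x * g x) ⊆ cube N := fun α =>
    (tsupport_multiDeriv_subset _ α).trans
      (tsupport_mul_subset_left.trans (hχs.trans interior_subset))
  have hUI : U ⊆ interior (cube N) := subset_closure.trans hU.2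
  have hev : ∀ᶠ n in atTop, ∀ α ∈ multiIndices N k,
      eLpNorm (fun x => conv (trigKernel n) (multiDeriv α fun x => χ x * g x) x -
        multiDeriv α (fun x => χ x * g x) x) 2 (volume.restrict U) ≤ ε := by
    rw [eventually_all_finset]
    exact fun α _ => eventually_eLpNorm_conv_trigKernel_sub_le hUo hUI
      (hφ.multiDeriv α).continuous (hs α) hε
  obtain ⟨n, hn⟩ := hev.exists
  -- Derivatives pass to `χ g`, so the same `n` serves every `α`.
  refine ⟨conv (trigKernel n) fun x => χ x * g x, isTrigPoly_conv_trigKernel n hφ.continuous hφc,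
    fun α hα => ?_⟩
  refine le_trans (le_of_eq (eLpNorm_congr_ae ?_)) (hn α ((mem_multiIndices α).2 hα))
  rw [EventuallyEq, ae_restrict_iff' hUo.measurableSet]
  refine Eventually.of_forall fun x hx => ?_
  have heq : Set.EqOn (fun x => χ x * g x) g U := fun y hy => by
    simp [(hχ1 y (subset_closure hy)).self_of_nhds]
  rw [multiDeriv_conv (continuous_trigKernel n).locallyIntegrable hφ hφc, heq.multiDeriv hUo α hx]

end Trigonometric

/-! ### Quantum models of trigonometric polynomials -/

section Quantum

open Matrix

variable {N : ℕ} {n : Type*}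

theorem tensorProd_mul [Fintype n] (A B : Fin N → Matrix n n ℂ) :
    tensorProd (fun i => A i * B i) = tensorProd A * tensorProd B := by
  ext J K
  simp only [tensorProd, of_apply, mul_apply, Finset.prod_univ_sum, Fintype.piFinset_univ,
    Finset.prod_mul_distrib]

theorem tensorProd_diagonal [DecidableEq n] (d : Fin N → n → ℂ) :
    tensorProd (fun i => diagonal (d i)) = diagonal fun J => ∏ i, d i (J i) := by
  ext J K
  simp only [tensorProd, of_apply, diagonal_apply]
  split_ifs with h
  · subst h
    simp
  · obtain ⟨i, hi⟩ := Function.ne_iff.1 h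
    exact Finset.prod_eq_zero (Finset.mem_univ i) (by simp [hi])

theorem tensorProd_conjTranspose (A : Fin N → Matrix n n ℂ) :
    (tensorProd A)ᴴ = tensorProd fun i => (A i)ᴴ := by
  ext J K
  simp [tensorProd, conjTranspose_apply]

variable [Fintype n] [DecidableEq n]

theorem tensorProd_conjTranspose_mul_self {V : Matrix n n ℂ} (hV : Vᴴ * V = 1) :
    (tensorProd fun _ : Fin N => V)ᴴ * (tensorProd fun _ : Fin N => V) = 1 := by
  rw [tensorProd_conjTranspose, ← tensorProd_mul]
  simp only [hV]
  rw [← diagonal_one, tensorProd_diagonal]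
  simp

/-- One `V` works for all `c`, so its tensor power diagonalises the encoding for every `x`. -/
theorem Matrix.IsHermitian.exists_exp_smul_eq {H : Matrix n n ℂ} (hH : H.IsHermitian) :
    ∃ V : Matrix n n ℂ, Vᴴ * V = 1 ∧ ∀ c : ℂ, NormedSpace.exp (c • H) =
      V * diagonal (fun j => Complex.exp (c * hH.eigenvalues j)) * Vᴴ := by
  set V : Matrix n n ℂ := (hH.eigenvectorUnitary : Matrix n n ℂ) with hV
  have h1 : Vᴴ * V = 1 := mem_unitaryGroup_iff'.1 hH.eigenvectorUnitary.2
  have h2 : V * Vᴴ = 1 := mem_unitaryGroup_iff.1 hH.eigenvectorUnitary.2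
  refine ⟨V, h1, fun c => ?_⟩
  have hs : H = V * diagonal (RCLike.ofReal ∘ hH.eigenvalues) * Vᴴ := by
    conv_lhs => rw [hH.spectral_theorem]
    rw [Unitary.conjStarAlgAut_apply]
    rfl
  have hc : c • H = V * diagonal (fun j => c * hH.eigenvalues j) * Vᴴ := by
    conv_lhs => rw [hs]
    rw [← Matrix.smul_mul, ← Matrix.mul_smul, ← diagonal_smul]
    rfl
  have hexp := Matrix.exp_units_conj (⟨V, Vᴴ, h2, h1⟩ : (Matrix n n ℂ)ˣ)
    (diagonal fun j => c * hH.eigenvalues j)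
  rw [hc]
  refine hexp.trans ?_
  rw [Matrix.exp_diagonal]
  congr 3
  funext j
  rw [Pi.coe_exp, Complex.exp_eq_exp_ℂ]

theorem encoding_eq {H V : Matrix n n ℂ} (hH : H.IsHermitian)
    (hV : ∀ c : ℂ, NormedSpace.exp (c • H) =
      V * diagonal (fun j => Complex.exp (c * hH.eigenvalues j)) * Vᴴ)
    (x : EuclideanSpace ℝ (Fin N)) :
    encoding H x = tensorProd (fun _ => V) *
      diagonal (fun J : Fin N → n =>
        Complex.exp (-(Complex.I * ∑ i, (x i : ℂ) * hH.eigenvalues (J i)))) *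
      (tensorProd fun _ => V)ᴴ := by
  simp only [encoding, hV]
  rw [tensorProd_mul, tensorProd_mul, tensorProd_diagonal, tensorProd_conjTranspose]
  congr 3
  funext J
  rw [← Complex.exp_sum, Finset.mul_sum, ← Finset.sum_neg_distrib]
  congr 1
  refine Finset.sum_congr rfl fun i _ => ?_
  ring

/-- The matrix whose quadratic form is `v ↦ Re (2 c conj(v a) v b)`. -/
theorem isHermitian_single_add_single {ι : Type*} [DecidableEq ι] (a b : ι) (c : ℂ) :
    (single a b c + single b a (star c)).IsHermitian := by
  rw [IsHermitian, conjTranspose_add, conjTranspose_single, conjTranspose_single, star_star,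
    add_comm]

theorem star_dotProduct_single_add_single_mulVec {ι : Type*} [Fintype ι] [DecidableEq ι]
    (a b : ι) (c : ℂ) (v : ι → ℂ) :
    star v ⬝ᵥ ((single a b c + single b a (star c)) *ᵥ v) =
      ((2 * (c * (star (v a) * v b)).re : ℝ) : ℂ) := by
  have h1 : ∀ (a b : ι) (c : ℂ), star v ⬝ᵥ (single a b c *ᵥ v) = c * (star (v a) * v b) := by
    intro a b c
    rw [single_mulVec]
    change star v ⬝ᵥ Pi.single a (c * v b) = _
    rw [dotProduct_single]
    simp only [Pi.star_apply]
    ring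
  rw [add_mulVec, dotProduct_add, h1, h1, ← Complex.add_conj]
  congr 1
  simp only [← starRingEnd_apply, map_mul, Complex.conj_conj]
  ring

/-- State and observable are prescribed in the eigenbasis by `γ` and `A`; the unitaries cancel and
only the phases on `γ` remain. -/
theorem expectation_eq {H V : Matrix n n ℂ} (hH : H.IsHermitian) (hV1 : Vᴴ * V = 1)
    (hV : ∀ c : ℂ, NormedSpace.exp (c • H) =
      V * diagonal (fun j => Complex.exp (c * hH.eigenvalues j)) * Vᴴ)
    (γ : (Fin N → n) → ℂ) (A : Matrix (Fin N → n) (Fin N → n) ℂ)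
    (x : EuclideanSpace ℝ (Fin N)) (v : (Fin N → n) → ℂ)
    (hv : ∀ J, v J =
      Complex.exp (-(Complex.I * ∑ i, (x i : ℂ) * hH.eigenvalues (J i))) * γ J) :
    expectation H ((tensorProd fun _ => V) *ᵥ γ)
      ((tensorProd fun _ => V) * A * (tensorProd fun _ => V)ᴴ) x = star v ⬝ᵥ (A *ᵥ v) := by
  have hW := tensorProd_conjTranspose_mul_self (N := N) hV1
  set W : Matrix (Fin N → n) (Fin N → n) ℂ := tensorProd fun _ => V
  have hS : encoding H x *ᵥ (W *ᵥ γ) = W *ᵥ v := by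
    rw [encoding_eq hH hV, mulVec_mulVec, mul_assoc, hW, mul_one, ← mulVec_mulVec]
    congr 1
    funext J
    rw [mulVec_diagonal, hv]
  rw [expectation, ← mulVec_mulVec, ← mulVec_mulVec, hS, dotProduct_mulVec, ← star_mulVec, hS,
    star_mulVec, ← dotProduct_mulVec, mulVec_mulVec, mulVec_mulVec, mul_assoc, mul_assoc, hW,
    mul_one, ← mul_assoc, hW, one_mul]

/-- Trigonometric polynomials are quantum models, if the frequencies are available. -/
theorem exists_quantumModel_eq {H : Matrix n n ℂ} (hH : H.IsHermitian) {ι : Type*}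
    (s : Finset ι) (ν : ι → Fin N → ℤ) (c : ι → ℂ) (h0 : (0 : ℝ) ∈ frequencySpectrum hH)
    (hν : ∀ j ∈ s, ∀ i, (ν j i : ℝ) ∈ frequencySpectrum hH) :
    ∃ (Γ : (Fin N → n) → ℂ) (M : Matrix (Fin N → n) (Fin N → n) ℂ), IsState Γ ∧
      M.IsHermitian ∧ ∀ x, quantumModel H Γ M x =
        (∑ j ∈ s, c j * Complex.exp (Complex.I * ∑ i, (ν j i : ℂ) * (x i : ℂ))).re := by
  have hne : Nonempty n := ⟨h0.choose⟩
  -- `a j` and `b j` label product basis vectors: the tensor structure lets each coordinate of the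
  -- frequency be chosen independently.
  choose! a b hab using hν
  obtain ⟨V, hV1, hV⟩ := hH.exists_exp_smul_eq
  have hW := tensorProd_conjTranspose_mul_self (N := N) hV1
  set W : Matrix (Fin N → n) (Fin N → n) ℂ := tensorProd fun _ => V with hWdef
  set D : ℝ := (Fintype.card (Fin N → n) : ℝ) with hD
  have hD0 : 0 < D := by
    rw [hD]
    exact_mod_cast Fintype.card_pos
  -- In the uniform superposition every product `conj (γ a) * γ b` is `D⁻¹`, so every pair of labels
  -- is usable.
  set γ : (Fin N → n) → ℂ := fun _ => ((Real.sqrt D)⁻¹ : ℝ) with hγ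
  have hsq : (Real.sqrt D)⁻¹ * (Real.sqrt D)⁻¹ = D⁻¹ := by
    rw [← mul_inv, Real.mul_self_sqrt hD0.le]
  -- The factor `D / 2` offsets the weight `D⁻¹` and the doubling caused by adding the adjoint
  -- entry.
  set A : Matrix (Fin N → n) (Fin N → n) ℂ := ∑ j ∈ s,
    (single (a j) (b j) (((D / 2 : ℝ) : ℂ) * c j) +
      single (b j) (a j) (star (((D / 2 : ℝ) : ℂ) * c j))) with hA
  have hAh : A.IsHermitian := by
    rw [IsHermitian, hA, conjTranspose_sum]
    exact Finset.sum_congr rfl fun j _ => isHermitian_single_add_single _ _ _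
  refine ⟨W *ᵥ γ, W * A * Wᴴ, ?_, isHermitian_mul_mul_conjTranspose _ hAh, fun x => ?_⟩
  · rw [IsState, star_mulVec, dotProduct_mulVec, vecMul_vecMul, hW, vecMul_one]
    simp only [hγ, dotProduct, Pi.star_apply, Complex.star_def, Complex.conj_ofReal,
      ← Complex.ofReal_mul, hsq, Finset.sum_const, Finset.card_univ, nsmul_eq_mul]
    rw [← Complex.ofReal_natCast, ← Complex.ofReal_mul, ← hD, mul_inv_cancel₀ hD0.ne',
      Complex.ofReal_one]
  · rw [quantumModel, hWdef, expectation_eq hH hV1 hV γ A x _ fun _ => rfl, hA, sum_mulVec,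
      dotProduct_sum, Complex.re_sum, Complex.re_sum]
    refine Finset.sum_congr rfl fun j hj => ?_
    rw [star_dotProduct_single_add_single_mulVec, Complex.ofReal_re]
    have hexp : star (Complex.exp (-(Complex.I * ∑ i, (x i : ℂ) * hH.eigenvalues (a j i))) *
        γ (a j)) * (Complex.exp (-(Complex.I * ∑ i, (x i : ℂ) * hH.eigenvalues (b j i))) *
        γ (b j)) = ((D⁻¹ : ℝ) : ℂ) *
          Complex.exp (Complex.I * ∑ i, (ν j i : ℂ) * (x i : ℂ)) := by
      have h1 : ∀ i, (ν j i : ℂ) = hH.eigenvalues (a j i) - hH.eigenvalues (b j i) := by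
        intro i
        have := hab j hj i
        exact_mod_cast congrArg (fun r : ℝ => (r : ℂ)) this
      have h2 : Complex.I * ∑ i, (ν j i : ℂ) * (x i : ℂ) =
          Complex.I * ∑ i, (x i : ℂ) * hH.eigenvalues (a j i) +
            -(Complex.I * ∑ i, (x i : ℂ) * hH.eigenvalues (b j i)) := by
        rw [← sub_eq_add_neg, ← mul_sub, ← Finset.sum_sub_distrib]
        congr 1
        refine Finset.sum_congr rfl fun i _ => ?_
        rw [h1]
        ring
      rw [h2, Complex.exp_add, ← hsq]
      simp only [hγ, ← starRingEnd_apply, map_mul, ← Complex.exp_conj, map_neg, map_sum,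
        Complex.conj_I, Complex.conj_ofReal, neg_mul, neg_neg, Complex.ofReal_mul]
      ring
    rw [hexp]
    have h3 : ((D / 2 : ℝ) : ℂ) * c j * (((D⁻¹ : ℝ) : ℂ) *
        Complex.exp (Complex.I * ∑ i, (ν j i : ℂ) * (x i : ℂ))) = ((1 / 2 : ℝ) : ℂ) *
        (c j * Complex.exp (Complex.I * ∑ i, (ν j i : ℂ) * (x i : ℂ))) := by
      have : ((D / 2 : ℝ) : ℂ) * ((D⁻¹ : ℝ) : ℂ) = ((1 / 2 : ℝ) : ℂ) := by
        rw [← Complex.ofReal_mul]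
        congr 1
        field_simp
      rw [← this]
      ring
    rw [h3, Complex.re_ofReal_mul]
    ring

end Quantum

/-! ### Universality -/

section Universality

open MeasureTheory

variable {N : ℕ}

/-- `weakDeriv` is an arbitrary choice; by uniqueness a bound for any weak derivative transfers to
it. -/
theorem HasWeakDeriv.integral_sq_weakDeriv_le {U : Set (Eucl N)} (hU : IsOpen U)
    {α : Fin N → ℕ} {f g : Eucl N → ℝ} (h : HasWeakDeriv U α f g)
    (hm : AEStronglyMeasurable g (volume.restrict U)) {η : ℝ} (hη : 0 ≤ η)
    (hg : eLpNorm g 2 (volume.restrict U) ≤ ENNReal.ofReal η) :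
    ∫ x in U, |weakDeriv U α f x| ^ 2 ≤ η ^ 2 := by
  have hw : HasWeakDeriv U α f (weakDeriv U α f) := by
    have hex : ∃ g, HasWeakDeriv U α f g := ⟨g, h⟩
    rw [weakDeriv, dif_pos hex]
    exact hex.choose_spec
  have h1 : ∫ x in U, |weakDeriv U α f x| ^ 2 = ∫ x in U, |g x| ^ 2 := by
    refine integral_congr_ae ?_
    filter_upwards [hw.ae_eq hU h] with x hx
    rw [hx]
  have hm2 : AEStronglyMeasurable (fun x => |g x| ^ 2) (volume.restrict U) := hm.norm.pow 2
  rw [h1, integral_eq_lintegral_of_nonneg_ae (Filter.Eventually.of_forall fun x => by positivity)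
    hm2]
  have h2 : ∀ x, ENNReal.ofReal (|g x| ^ 2) = ‖g x‖ₑ ^ 2 := fun x => by
    rw [ENNReal.ofReal_pow (abs_nonneg _), Real.enorm_eq_ofReal_abs]
  simp only [h2]
  rw [← eLpNorm_two_sq]
  refine ENNReal.toReal_le_of_le_ofReal (by positivity) ?_
  rw [ENNReal.ofReal_pow hη]
  exact pow_le_pow_left' hg 2

/-- Trigonometric polynomials are dense in the Sobolev space of a Lipschitz domain which is
compactly contained in the cube. -/
theorem MemSobolev.exists_isTrigPoly {k : ℕ} {U : Set (Eucl N)} (hUopen : IsOpen U)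
    (hUcube : CompactlyContained U (cube N)) (hULip : HasLipschitzBoundary U) {f : Eucl N → ℝ}
    (hf : MemSobolev k U f) {ε : ℝ} (hε : 0 < ε) :
    ∃ q, IsTrigPoly q ∧ MemSobolev k U (fun x => q x - f x) ∧
      sobolevNorm k U (fun x => q x - f x) < ε := by
  -- The squared norm has `C - 1` terms, each at most `η²` for `η = ε / (2 C)`, and `(C - 1) η² < (2
  -- C)² η² = ε²`. The two approximations share `η` equally.
  set C : ℝ := (multiIndices N k).card + 1 with hC
  have hC1 : 1 ≤ C := by
    rw [hC]
    linarith [Nat.cast_nonneg (α := ℝ) (multiIndices N k).card]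
  set η : ℝ := ε / (2 * C) with hηdef
  have hη : 0 < η := by positivity
  have hδ : ENNReal.ofReal η / 2 ≠ 0 := (ENNReal.half_pos (by simpa using hη)).ne'
  obtain ⟨g, hg, hfg⟩ := hf.exists_sobolevClose hUopen hUcube.1 hULip hδ
  obtain ⟨q, hq, hgq⟩ := exists_isTrigPoly_eLpNorm_le hUopen hUcube hg k hδ
  have key : ∀ α : Fin N → ℕ, ∑ i, α i ≤ k → ∃ w, HasWeakDeriv U α (fun x => q x - f x) w ∧
      MemLp w 2 (volume.restrict U) ∧ eLpNorm w 2 (volume.restrict U) ≤ ENNReal.ofReal η := by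
    intro α hα
    obtain ⟨h, h1, h2, h3⟩ := hfg α hα
    have hmq := (hq.contDiff.multiDeriv α).continuous.aestronglyMeasurable
      (μ := volume.restrict U)
    have hmg := (hg.multiDeriv α).continuous.aestronglyMeasurable (μ := volume.restrict U)
    have hle : eLpNorm (fun x => multiDeriv α q x - h x) 2 (volume.restrict U) ≤
        ENNReal.ofReal η := by
      have e : (fun x => multiDeriv α q x - h x) =
          (fun x => multiDeriv α q x - multiDeriv α g x) +
            (fun x => multiDeriv α g x - h x) := by
        funext x
        simp
      rw [e]
      refine (eLpNorm_add_le (hmq.sub hmg) (hmg.sub h2.1) (by norm_num)).trans ?_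
      exact (add_le_add (hgq α hα) h3).trans (ENNReal.add_halves _).le
    exact ⟨_, (hq.contDiff.hasWeakDeriv U α).sub h1,
      ⟨hmq.sub h2.1, hle.trans_lt ENNReal.ofReal_lt_top⟩, hle⟩
  refine ⟨q, hq, ⟨?_, fun α hα => ?_⟩, ?_⟩
  · obtain ⟨χ, hχ, hχc, -, hχ1⟩ := exists_smooth_cutoff hUcube.1 isOpen_univ (Set.subset_univ _)
    have hqχ : MemLp (fun x => χ x * q x) 2 (volume.restrict U) :=
      (hχ.continuous.mul hq.contDiff.continuous).memLp_of_hasCompactSupport hχc.mul_right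
    have hqL : MemLp q 2 (volume.restrict U) := by
      refine (memLp_congr_ae ?_).1 hqχ
      rw [Filter.EventuallyEq, ae_restrict_iff' hUopen.measurableSet]
      exact Filter.Eventually.of_forall fun x hx => by
        simp [(hχ1 x (subset_closure hx)).self_of_nhds]
    exact hqL.sub hf.1
  · obtain ⟨w, h1, h2, -⟩ := key α hα
    exact ⟨w, h1, h2⟩
  · rw [sobolevNorm, Real.sqrt_lt' hε]
    have hsum : ∑ α ∈ multiIndices N k, ∫ x in U, |weakDeriv U α (fun x => q x - f x) x| ^ 2 ≤
        (multiIndices N k).card • η ^ 2 := by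
      refine Finset.sum_le_card_nsmul _ _ _ fun α hα => ?_
      obtain ⟨w, h1, h2, h3⟩ := key α ((mem_multiIndices α).1 hα)
      exact h1.integral_sq_weakDeriv_le hUopen h2.1 hη.le h3
    refine hsum.trans_lt ?_
    rw [nsmul_eq_mul]
    have hηC : η * (2 * C) = ε := div_mul_cancel₀ _ (by positivity)
    have hcard : ((multiIndices N k).card : ℝ) = C - 1 := by rw [hC]; ring
    have hη2 : 0 < η ^ 2 := pow_pos hη 2
    calc ((multiIndices N k).card : ℝ) * η ^ 2 = (C - 1) * η ^ 2 := by rw [hcard]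
      _ < (2 * C) ^ 2 * η ^ 2 := mul_lt_mul_of_pos_right (by nlinarith) hη2
      _ = ε ^ 2 := by rw [← hηC]; ring

end Universality

theorem theorem4 (N k d : ℕ)
    (H : ∀ m : ℕ, Matrix (Fin m → Fin d) (Fin m → Fin d) ℂ)
    (hH : ∀ m, (H m).IsHermitian) (hU : IsUniversalFamily hH)
    (U : Set (EuclideanSpace ℝ (Fin N))) (hUopen : IsOpen U)
    (hUcube : CompactlyContained U (cube N)) (hULip : HasLipschitzBoundary U)
    (f : EuclideanSpace ℝ (Fin N) → ℝ) (hf : MemSobolev k U f)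
    (ε : ℝ) (hε : 0 < ε) :
    ∃ (m' : ℕ) (Γ : (Fin N → Fin m' → Fin d) → ℂ)
      (M : Matrix (Fin N → Fin m' → Fin d) (Fin N → Fin m' → Fin d) ℂ),
      IsState Γ ∧ M.IsHermitian ∧
      MemSobolev k U (fun x => quantumModel (H m') Γ M x - f x) ∧
      sobolevNorm k U (fun x => quantumModel (H m') Γ M x - f x) < ε := by
  obtain ⟨q, ⟨ι, s, ν, c, hq⟩, hmem, hnorm⟩ := hf.exists_isTrigPoly hUopen hUcube hULip hε
  -- `K` is the largest absolute value of a frequency coordinate of `q`.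
  obtain ⟨m, hm⟩ := hU (s.sup fun j => Finset.univ.sup fun i => (ν j i).natAbs)
  obtain ⟨Γ, M, hΓ, hM, hqm⟩ := exists_quantumModel_eq (N := N) (hH m) s ν c
    (by simpa using hm 0 (by simp)) (fun j hj i => hm _ (by
      rw [Int.abs_eq_natAbs]
      have h1 := Finset.le_sup (f := fun i => (ν j i).natAbs) (Finset.mem_univ i)
      have h2 := Finset.le_sup (f := fun j => Finset.univ.sup fun i => (ν j i).natAbs) hj
      exact_mod_cast h1.trans h2))
  have hfun : (fun x => quantumModel (H m) Γ M x - f x) = fun x => q x - f x := by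
    funext x
    rw [hqm, hq]
  refine ⟨m, Γ, M, hΓ, hM, ?_, ?_⟩
  · rw [hfun]
    exact hmem
  · rw [hfun]
    exact hnorm
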